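/- Let $\gamma>1$, $M_\gamma=\{\zeta\in\mathbb C^2:\operatorname{Im}\zeta_2=|\zeta_1|^\gamma\}$ and $\Omega_\gamma=\{z\in\mathbb C^2:\operatorname{Im}z_2>|z_1|^\gamma\}$. Parametrize $M_\gamma$ by $\zeta=(\alpha e^{i\theta},\,s+i\alpha^\gamma)$ with $s\in\mathbb R$, $\alpha\ge 0$, $\theta\in[0,2\pi)$, orient it by $ds\wedge d\alpha\wedge d\theta$, and let $\sigma=\alpha^{\gamma-1}\,ds\,d\alpha\,d\theta$. With the defining function $\rho(z)=|z_1|^\gamma-\operatorname{Im}z_2$, the Leray integral of $f\in L^2(M_\gamma,\sigma)$ is $$ \boldsymbol Lf(z)=\frac{1}{(2\pi i)^2}\int_{M_\gamma} f(\zeta)\,\frac{\partial\rho(\zeta)\wedge\bar\partial\partial\rho(\zeta)}{\langle\partial\rho(\zeta),\zeta-z\rangle^2} =\frac{\gamma^2}{4\pi^2}\int_{M_\gamma}\frac{f(\zeta)\,d\sigma(\zeta)}{\big[\gamma\bar\zeta_1|\zeta_1|^{\gamma-2}(\zeta_1-z_1)+i(\zeta_2-z_2)\big]^2},\qquad z\in\Omega_\gamma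 . $$ Then for every $f\in L^2(M_\gamma,\sigma)$ this integral converges absolutely for all $z\in\Omega_\gamma$; for each $\varepsilon>0$ the function $\zeta\mapsto \boldsymbol Lf(\zeta_1,\zeta_2+i\varepsilon)$ on $M_\gamma$ belongs to $L^2(M_\gamma,\sigma)$, and as $\varepsilon\to0^+$ these functions converge in $L^2(M_\gamma,\sigma)$. The limit, again denoted $\boldsymbol Lf$, is the Leray transform of $f$ on $M_\gamma$. The operator $\boldsymbol L\colon L^2(M_\gamma,\sigma)\to L^2(M_\gamma,\sigma)$ is a bounded linear projection, $\boldsymbol L\circ\boldsymbol L=\boldsymbol L$, with norm $$ \|\boldsymbol L\|_{L^2(M_\gamma,\sigma)}=\frac{\gamma}{2\sqrt{\gamma-1}} . $$ Moreover there is an infinite-dimensional linear subspace $V\subset L^2(M_\gamma,\sigma)$ such that $\|\boldsymbol Lf\|=\frac{\gamma}{2\sqrt{\gamma-1}}\|f\|$ for all $f\in V$, and the essential norm of $\boldsymbol L$ (its distance in operator norm to the compact operators on $L^2(M_\gamma,\sigma)$) also equals $\frac{\gamma}{2\sqrt{\gamma-1}}$. -/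

import Mathlib

open MeasureTheory Filter Topology Set

noncomputable section

namespace Leray

/-! ### Forms on `ℂ²` -/

/-- The `(1,0)`-form `∂F(ζ) = ∑ⱼ (∂F/∂zⱼ)(ζ) dzⱼ`, evaluated at the vector `v`. -/
def del (F : ℂ × ℂ → ℂ) (ζ v : ℂ × ℂ) : ℂ :=
  (fderiv ℝ F ζ v - Complex.I * fderiv ℝ F ζ (Complex.I • v)) / 2

/-- The `(0,1)`-form `∂̄F(ζ) = ∑ⱼ (∂F/∂z̄ⱼ)(ζ) dz̄ⱼ`, evaluated at the vector `v`. -/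
def delBar (F : ℂ × ℂ → ℂ) (ζ v : ℂ × ℂ) : ℂ :=
  (fderiv ℝ F ζ v + Complex.I * fderiv ℝ F ζ (Complex.I • v)) / 2

/-- The `(1,1)`-form `∂̄∂F(ζ) = ∑ⱼₖ (∂²F/∂z̄ⱼ∂zₖ)(ζ) dz̄ⱼ ∧ dzₖ`, evaluated at `v, w`. -/
def delBarDel (F : ℂ × ℂ → ℂ) (ζ v w : ℂ × ℂ) : ℂ :=
  delBar (fun ξ => del F ξ w) ζ v - delBar (fun ξ => del F ξ v) ζ w

/-- The Leray kernel in `ℂ²` of a hypersurface with defining function `ρ`: the `(2,1)`-form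
`(2πi)⁻² ∂ρ(ζ) ∧ ∂̄∂ρ(ζ) / ⟨∂ρ(ζ), ζ - z⟩²`, evaluated at the tangent vectors `u, v, w`. -/
def kernel (ρ : ℂ × ℂ → ℝ) (z ζ u v w : ℂ × ℂ) : ℂ :=
  let F : ℂ × ℂ → ℂ := fun ξ => (ρ ξ : ℂ)
  1 / (2 * Real.pi * Complex.I) ^ 2 *
    (del F ζ u * delBarDel F ζ v w - del F ζ v * delBarDel F ζ u w
      + del F ζ w * delBarDel F ζ u v) / (del F ζ (ζ - z)) ^ 2

/-! ### The model hypersurface -/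

/-- `M_γ = {Im ζ₂ = |ζ₁|^γ}`. -/
def M (γ : ℝ) : Set (ℂ × ℂ) := {ζ | ζ.2.im = ‖ζ.1‖ ^ γ}

/-- `Ω_γ = {Im z₂ > |z₁|^γ}`. -/
def Omega (γ : ℝ) : Set (ℂ × ℂ) := {z | ‖z.1‖ ^ γ < z.2.im}

/-- The defining function `ρ(z) = |z₁|^γ - Im z₂`. -/
def rho (γ : ℝ) (z : ℂ × ℂ) : ℝ := ‖z.1‖ ^ γ - z.2.im

/-- The parametrization `(s, α, θ) ↦ (α e^{iθ}, s + i α^γ)` of `M_γ`; it is used for `α > 0`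
only, and `|α|` makes it take values in `M_γ` for all `α`. -/
def chart (γ : ℝ) (p : ℝ × ℝ × ℝ) : ℂ × ℂ :=
  (p.2.1 * Complex.exp (p.2.2 * Complex.I), p.1 + (|p.2.1| ^ γ : ℝ) * Complex.I)

/-- The parameters `s ∈ ℝ`, `α > 0`, `0 ≤ θ < 2π`, which cover `M_γ` up to the line `ζ₁ = 0`. -/
def params : Set (ℝ × ℝ × ℝ) := univ ×ˢ Ioi 0 ×ˢ Ico 0 (2 * Real.pi)

theorem chart_mem (γ : ℝ) (p : ℝ × ℝ × ℝ) : chart γ p ∈ M γ := by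
  simp [chart, M, Complex.norm_exp_ofReal_mul_I]

/-- The parametrization as a map into `M_γ`. -/
def param (γ : ℝ) (p : ℝ × ℝ × ℝ) : M γ := ⟨chart γ p, chart_mem γ p⟩

/-- The measure `σ = α^{γ-1} ds dα dθ` on `M_γ`. -/
def sigma (γ : ℝ) : Measure (M γ) :=
  Measure.map (param γ)
    ((volume.restrict params).withDensity fun p => ENNReal.ofReal (p.2.1 ^ (γ - 1)))

/-! ### The Leray transform of `M_γ` -/

/-- The pullback to the parameters `(s, α, θ)` of the form `f(ζ) · (Leray kernel)(z, ζ)`,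
as a multiple of `ds ∧ dα ∧ dθ`. -/
def integrand (γ : ℝ) (f : M γ → ℂ) (z : ℂ × ℂ) (p : ℝ × ℝ × ℝ) : ℂ :=
  f (param γ p) * kernel (rho γ) z (chart γ p)
    (fderiv ℝ (chart γ) p (1, 0, 0)) (fderiv ℝ (chart γ) p (0, 1, 0))
    (fderiv ℝ (chart γ) p (0, 0, 1))

/-- The Leray integral `∫_{M_γ} f(ζ) (Leray kernel)(z, ζ)`, where `M_γ` is oriented by
`ds ∧ dα ∧ dθ`. -/
def transform (γ : ℝ) (f : M γ → ℂ) (z : ℂ × ℂ) : ℂ :=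
  ∫ p in params, integrand γ f z p

/-- The translate of `ζ` by `(0, iε)`. It maps `M_γ` into `Ω_γ` for `ε > 0`. -/
def lift (ε : ℝ) (ζ : ℂ × ℂ) : ℂ × ℂ := (ζ.1, ζ.2 + ε * Complex.I)

/-- `g` is the Leray transform of `f` on `M_γ`: the Leray integral of `f` converges absolutely on
`Ω_γ`, and the function on `Ω_γ` that it defines has boundary values `g` in `L²(M_γ, σ)`. -/
def IsTransform (γ : ℝ) (f g : M γ → ℂ) : Prop :=
  (∀ z ∈ Omega γ, IntegrableOn (integrand γ f z) params) ∧
  (∀ ε : ℝ, 0 < ε → MemLp (fun ζ : M γ => transform γ f (lift ε ζ)) 2 (sigma γ)) ∧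
  Tendsto (fun ε : ℝ => eLpNorm (fun ζ : M γ => transform γ f (lift ε ζ) - g ζ) 2 (sigma γ))
    (𝓝[>] 0) (𝓝 0)

/-- The essential norm of a bounded operator: its distance to the compact operators. -/
def essentialNorm {E : Type*} [NormedAddCommGroup E] [NormedSpace ℂ E] (T : E →L[ℂ] E) : ℝ :=
  Metric.infDist T {K : E →L[ℂ] E | IsCompactOperator K}

end Leray

end

noncomputable section

namespace Leray

/-! ### Diagonal operators, orthogonal families and the essential norm -/

section Hilbert

variable {H G : Type*} [NormedAddCommGroup H] [InnerProductSpace ℂ H]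
  [NormedAddCommGroup G] [InnerProductSpace ℂ G]

/-! For `z ∈ Ω_γ` the conjugate of the kernel is `γ²/(4π²) · (Y - X)⁻²`, where `X = γ|ζ₁|^(γ-1)
(ζ₁/|ζ₁|) z̄₁` and `Y = (γ-1)|ζ₁|^γ - i Re ζ₂ + i z̄₂`. Young's inequality gives `|X| < Re Y`, so
`(Y - X)⁻² = ∑ (k+1) X^k / Y^(k+2)`, and `Y^(-(k+2))` is a Laplace integral of `t^(k+1) e^(-Yt)`
(`wave_coeff`, `hasSum_wave_coeff`). Hence for each angular frequency `k ≥ 0` and each frequency `t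
> 0` in `s` the transform has rank one: it pairs `f` with `α^((γ-1)k) e^(-t(γ-1)α^γ)` and returns a
multiple of `α^k e^(-tα^γ)`.

By homogeneity these two profiles, normalized in `L²(α^(γ-1) dα)`, have an inner product `c_k > 0`
independent of `t`. With the isometries `A_k` (`inWave`) and `B_k` (`outWave`) of `L²(0,∞)` into
`L²(σ)`, this says `L = ∑ c_k⁻¹ B_k A_k*` and `A_k* B_k = c_k`, different `k` being orthogonal. So
`L² = L` and `‖L‖ = sup c_k⁻¹`.

The supremum is attained at `k = 0`, where `c_0 = 2√(γ-1)/γ`. The inequality `c_k ≥ c_0` is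
equivalent to an inequality for Gamma values (`gain_le`), which follows from the concavity of `log
Γ(1+x) - x log x`, read off from Euler's limit. The range of `A_0` is a copy of `L²(0,∞)` on which
`L` multiplies norms by `c_0⁻¹`; compact perturbations cannot lower this factor
(`le_norm_sub_of_isCompactOperator`).

Shifting `z₂` by `iε` multiplies frequency `t` by `e^(-εt)`, so the boundary values are a strong
limit of damped operators (`transform_lift_ae`, `tendsto_lerayDamped`). -/

theorem memlp_diag {T : ℕ → G →L[ℂ] G} {C : ℝ} (hT : ∀ k, ‖T k‖ ≤ C)
    (g : lp (fun _ : ℕ => G) 2) : Memℓp (fun k => T k (g k)) 2 := by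
  have hg := lp.memℓp g
  rw [memℓp_gen_iff (by norm_num)] at hg ⊢
  refine Summable.of_nonneg_of_le (fun k => by positivity) (fun k => ?_) (hg.mul_left (C ^ 2))
  simp only [ENNReal.toReal_ofNat, Real.rpow_two]
  rw [← mul_pow]
  gcongr
  exact ((T k).le_opNorm _).trans (by gcongr; exact hT k)

theorem norm_sq_lp_eq_tsum {G : Type*} [NormedAddCommGroup G] (g : lp (fun _ : ℕ => G) 2) :
    ‖g‖ ^ 2 = ∑' k, ‖g k‖ ^ 2 := by
  have := lp.norm_rpow_eq_tsum (p := 2) (by norm_num) g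
  simpa using this

theorem summable_norm_sq_lp {G : Type*} [NormedAddCommGroup G] (g : lp (fun _ : ℕ => G) 2) :
    Summable fun k => ‖g k‖ ^ 2 := by
  have hg := lp.memℓp g
  rw [memℓp_gen_iff (by norm_num)] at hg
  simpa using hg

/-- The diagonal operator on `ℓ²(ℕ, G)` with uniformly bounded entries. -/
def diag (T : ℕ → G →L[ℂ] G) (C : ℝ) (hC : 0 ≤ C) (hT : ∀ k, ‖T k‖ ≤ C) :
    lp (fun _ : ℕ => G) 2 →L[ℂ] lp (fun _ : ℕ => G) 2 :=
  LinearMap.mkContinuous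
    { toFun := fun g => ⟨fun k => T k (g k), memlp_diag hT g⟩
      map_add' := fun f g => by ext k; exact map_add (T k) _ _
      map_smul' := fun c f => by ext k; exact map_smul (T k) _ _ } C (fun g => by
      refine le_of_sq_le_sq ?_ (by positivity)
      rw [mul_pow, norm_sq_lp_eq_tsum, norm_sq_lp_eq_tsum, ← tsum_mul_left]
      refine Summable.tsum_le_tsum (fun k => ?_) (summable_norm_sq_lp _)
        ((summable_norm_sq_lp g).mul_left _)
      rw [← mul_pow]
      gcongr
      exact ((T k).le_opNorm _).trans (by gcongr; exact hT k))

theorem norm_diag_le (T : ℕ → G →L[ℂ] G) (C : ℝ) (hC : 0 ≤ C) (hT : ∀ k, ‖T k‖ ≤ C) :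
    ‖diag T C hC hT‖ ≤ C :=
  LinearMap.mkContinuous_norm_le _ hC _

/-- Strong convergence of uniformly bounded diagonal operators, entry by entry. -/
theorem tendsto_of_tendsto_entries {G ι : Type*} [NormedAddCommGroup G] {l : Filter ι}
    [l.IsCountablyGenerated] {C : ℝ}
    (g : lp (fun _ : ℕ => G) 2) (F : ι → lp (fun _ : ℕ => G) 2)
    (hF : ∀ i k, ‖F i k‖ ≤ C * ‖g k‖) (f : lp (fun _ : ℕ => G) 2)
    (hlim : ∀ k, Tendsto (fun i => F i k) l (𝓝 (f k))) : Tendsto F l (𝓝 f) := by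
  rw [tendsto_iff_norm_sub_tendsto_zero]
  have key : Tendsto (fun i => ∑' k, ‖(F i - f) k‖ ^ 2) l (𝓝 (∑' _ : ℕ, (0 : ℝ))) := by
    refine tendsto_tsum_of_dominated_convergence
      (bound := fun k => 2 * (C ^ 2 * ‖g k‖ ^ 2 + ‖f k‖ ^ 2)) ?_ ?_ ?_
    · exact (((summable_norm_sq_lp g).mul_left _).add (summable_norm_sq_lp f)).mul_left _
    · intro k
      have := tendsto_iff_norm_sub_tendsto_zero.1 (hlim k)
      simpa using this.pow 2
    · refine Eventually.of_forall fun i k => ?_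
      have h1 : ‖(F i - f) k‖ ≤ C * ‖g k‖ + ‖f k‖ := by
        rw [lp.coeFn_sub, Pi.sub_apply]
        exact (norm_sub_le _ _).trans (by gcongr; exact hF i k)
      rw [Real.norm_of_nonneg (by positivity)]
      calc ‖(F i - f) k‖ ^ 2 ≤ (C * ‖g k‖ + ‖f k‖) ^ 2 := by gcongr
        _ ≤ _ := by nlinarith [sq_nonneg (C * ‖g k‖ - ‖f k‖)]
  have h2 := key.sqrt
  simp only [tsum_zero, Real.sqrt_zero] at h2
  refine h2.congr fun i => ?_
  rw [← norm_sq_lp_eq_tsum, Real.sqrt_sq (norm_nonneg _)]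

/-- Pair with a vector supported in the slot `k`: synthesis sends it to the image under `A k`. -/
theorem adjoint_linearIsometry_apply [CompleteSpace H] [CompleteSpace G] {A : ℕ → G →ₗᵢ[ℂ] H}
    (hA : OrthogonalFamily ℂ (fun _ : ℕ => G) A) (f : H) (k : ℕ) :
    ContinuousLinearMap.adjoint hA.linearIsometry.toContinuousLinearMap f k
      = ContinuousLinearMap.adjoint (A k).toContinuousLinearMap f := by
  classical
  refine ext_inner_left ℂ fun φ => ?_
  rw [ContinuousLinearMap.adjoint_inner_right]
  have h1 := lp.inner_single_left (𝕜 := ℂ) (G := fun _ : ℕ => G) k φ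
    (ContinuousLinearMap.adjoint hA.linearIsometry.toContinuousLinearMap f)
  rw [← h1, ContinuousLinearMap.adjoint_inner_right]
  simp [OrthogonalFamily.linearIsometry_apply_single]

/-- A bounded operator that multiplies norms by `c` on an infinite-dimensional subspace is at
distance at least `c` from every compact operator. -/
theorem le_norm_sub_of_isCompactOperator {T K : H →L[ℂ] H} {c : ℝ} (V : Submodule ℂ H)
    (hV : ¬ FiniteDimensional ℂ V) (hT : ∀ f ∈ V, ‖T f‖ = c * ‖f‖) (hK : IsCompactOperator K) :
    c ≤ ‖T - K‖ := by
  -- Gram–Schmidt on a countable part of an algebraic basis of `V`.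
  have hinf : ∃ e : ℕ → V, Orthonormal ℂ e := by
    let b := Module.Free.chooseBasis ℂ V
    have : Infinite (Module.Free.ChooseBasisIndex ℂ V) := by
      by_contra h
      rw [not_infinite_iff_finite] at h
      exact hV (Module.Finite.of_basis b)
    let i := Infinite.natEmbedding (Module.Free.ChooseBasisIndex ℂ V)
    exact ⟨_, InnerProductSpace.gramSchmidtNormed_orthonormal
      (b.linearIndependent.comp i i.injective)⟩
  obtain ⟨e, he⟩ := hinf
  have hcpt := hK.isCompact_closure_image_closedBall 1
  obtain ⟨y, -, φ, hφ, hy⟩ := hcpt.tendsto_subseq (x := fun n => K (e n)) (fun n =>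
    subset_closure ⟨e n, by simpa using (he.1 n).le, rfl⟩)
  refine le_of_forall_pos_le_add fun δ hδ => ?_
  obtain ⟨n, hn⟩ := Metric.cauchySeq_iff'.1 hy.cauchySeq δ hδ
  have h1 := hn (n + 1) (by omega)
  have hne : φ (n + 1) ≠ φ n := fun h => by have := hφ.injective h; omega
  set v : V := e (φ (n + 1)) - e (φ n) with hv
  have hvn : ‖(v : H)‖ ^ 2 = 2 := by
    have := @norm_sub_sq ℂ V _ _ _ (e (φ (n + 1))) (e (φ n))
    rw [he.2 hne, he.1, he.1] at this
    rw [Submodule.norm_coe, hv, this]; norm_num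
  -- With `‖v‖ ≥ 1`, the bound `c‖v‖ ≤ ‖T - K‖‖v‖ + δ` implies `c ≤ ‖T - K‖ + δ`.
  have hv1 : 1 ≤ ‖(v : H)‖ := by nlinarith [norm_nonneg (v : H)]
  have hKv : ‖K v‖ ≤ δ := by
    rw [dist_eq_norm] at h1
    simpa [hv] using h1.le
  have h2 : c * ‖(v : H)‖ ≤ ‖T - K‖ * ‖(v : H)‖ + δ := by
    rw [← hT v v.2]
    calc ‖T v‖ = ‖(T - K) v + K v‖ := by simp
      _ ≤ _ := (norm_add_le _ _).trans (add_le_add ((T - K).le_opNorm _) hKv)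
  by_contra hcon
  push Not at hcon
  nlinarith

theorem essentialNorm_eq_of_forall_mem {T : H →L[ℂ] H} {c : ℝ} (V : Submodule ℂ H)
    (hV : ¬ FiniteDimensional ℂ V) (hT : ∀ f ∈ V, ‖T f‖ = c * ‖f‖) (hc : ‖T‖ = c) :
    essentialNorm T = c := by
  have h0 : (0 : H →L[ℂ] H) ∈ {K : H →L[ℂ] H | IsCompactOperator K} := isCompactOperator_zero
  apply le_antisymm
  · refine (Metric.infDist_le_dist_of_mem h0).trans ?_
    simp [hc]
  · refine (Metric.le_infDist ⟨0, h0⟩).2 fun K hK => ?_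
    rw [dist_eq_norm]
    exact le_norm_sub_of_isCompactOperator V hV hT hK

end Hilbert

/-! ### A sum that converges both in `Lᵖ` and pointwise -/

/-- Convergence in `L²` gives convergence in measure, so a subsequence of the partial sums converges
almost everywhere. This is the passage from expansions in Hilbert space to values of the kernel and
of the transform. -/
theorem ae_eq_of_hasSum {X : Type*} [MeasurableSpace X] {μ : Measure X} {F : ℕ → Lp ℂ 2 μ}
    {G : Lp ℂ 2 μ} (hF : HasSum F G) {f : ℕ → X → ℂ} (hf : ∀ k, F k =ᵐ[μ] f k) {g : X → ℂ}
    (hg : ∀ᵐ x ∂μ, HasSum (fun k => f k x) (g x)) : G =ᵐ[μ] g := by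
  have h1 := tendstoInMeasure_of_tendsto_Lp hF.tendsto_sum_nat
  obtain ⟨ns, hns, hlim⟩ := h1.exists_seq_tendsto_ae
  have hsum : ∀ n, (∑ k ∈ Finset.range n, F k : Lp ℂ 2 μ) =ᵐ[μ]
      fun x => ∑ k ∈ Finset.range n, f k x := fun n => by
    have h2 := Lp.coeFn_finsetSum (μ := μ) (p := 2) (E := ℂ) (Finset.range n) F
    have h3 : ∀ᵐ x ∂μ, ∀ k, F k x = f k x := ae_all_iff.2 hf
    filter_upwards [h2, h3] with x h2 h3
    rw [h2]
    simp [h3]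
  filter_upwards [hlim, hg, ae_all_iff.2 hsum] with x hl hg hs
  refine tendsto_nhds_unique hl ?_
  simp only [hs]
  exact hg.tendsto_sum_nat.comp hns.tendsto_atTop

/-! ### An inequality for the Gamma function -/

/-- The midpoint form of the concavity of `y ↦ y (log (y + 1) - log y)`. -/
theorem mul_log_succ_sub_log_add_le {x y : ℝ} (hx : 0 < x) (hy : 0 < y) :
    x * (Real.log (x + 1) - Real.log x) + y * (Real.log (y + 1) - Real.log y)
      ≤ 2 * ((x + y) / 2 * (Real.log ((x + y) / 2 + 1) - Real.log ((x + y) / 2))) := by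
  have hx' : (x + 1) / x ∈ Ioi (0 : ℝ) := div_pos (by positivity) hx
  have hy' : (y + 1) / y ∈ Ioi (0 : ℝ) := div_pos (by positivity) hy
  -- Jensen for `log` at `(x+1)/x` and `(y+1)/y` with weights `x/(x+y)` and `y/(x+y)`; the weighted
  -- mean is `(c+1)/c` with `c = (x+y)/2`.
  have h := strictConcaveOn_log_Ioi.concaveOn.2 hx' hy'
    (div_nonneg hx.le (add_pos hx hy).le) (div_nonneg hy.le (add_pos hx hy).le)
    (by field_simp)
  have e : x / (x + y) * ((x + 1) / x) + y / (x + y) * ((y + 1) / y)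
      = ((x + y) / 2 + 1) / ((x + y) / 2) := by field_simp; ring
  rw [smul_eq_mul, smul_eq_mul, smul_eq_mul, smul_eq_mul, e, Real.log_div (by positivity) hx.ne',
    Real.log_div (by positivity) hy.ne', Real.log_div (by positivity) (by positivity)] at h
  generalize Real.log (x + 1) - Real.log x = A at h ⊢
  generalize Real.log (y + 1) - Real.log y = B at h ⊢
  generalize Real.log ((x + y) / 2 + 1) - Real.log ((x + y) / 2) = C at h ⊢
  have h2 := mul_le_mul_of_nonneg_left h (by positivity : 0 ≤ x + y)
  calc x * A + y * B = (x + y) * (x / (x + y) * A + y / (x + y) * B) := by field_simp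
    _ ≤ (x + y) * C := h2
    _ = _ := by ring

theorem mul_log_add_ge {x y : ℝ} (hx : 0 < x) (hy : 0 < y) :
    2 * ((x + y) / 2 * Real.log ((x + y) / 2)) ≤ x * Real.log x + y * Real.log y := by
  have h := Real.convexOn_mul_log.2 (mem_Ici.2 hx.le) (mem_Ici.2 hy.le)
    (by norm_num : (0 : ℝ) ≤ 1 / 2) (by norm_num : (0 : ℝ) ≤ 1 / 2) (by norm_num)
  simp only [smul_eq_mul] at h
  rw [show 1 / 2 * x + 1 / 2 * y = (x + y) / 2 by ring] at h
  linarith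

/-- Summation by parts in Euler's limit. On the right every term is affine or concave in `x`:
translates of `y (log (y+1) - log y)`, and `-(x+n) log (x+n)`. -/
theorem logGammaSeq_add_log_sub (x : ℝ) (n : ℕ) :
    Real.BohrMollerup.logGammaSeq x n + Real.log x - x * Real.log x
      = x * Real.log n + Real.log n.factorial
        + ∑ m ∈ Finset.range n, (x + m) * (Real.log (x + m + 1) - Real.log (x + m))
        - (x + n) * Real.log (x + n) := by
  have h : ∀ n : ℕ, (∑ m ∈ Finset.range n, (x + m) * (Real.log (x + m + 1) - Real.log (x + m)))
      = (x + n) * Real.log (x + n) - x * Real.log x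
        - ∑ m ∈ Finset.range n, Real.log (x + (m + 1 : ℕ)) := by
    intro n
    induction n with
    | zero => simp
    | succ n ih =>
      rw [Finset.sum_range_succ, ih, Finset.sum_range_succ]
      push_cast
      rw [← add_assoc]
      ring
  rw [h, Real.BohrMollerup.logGammaSeq, Finset.sum_range_succ']
  simp
  ring

/-- The midpoint form of the concavity of `a ↦ log Γ(a) + log a - a log a`. -/
theorem log_Gamma_midpoint {a b : ℝ} (ha : 0 < a) (hb : 0 < b) :
    (Real.log (Real.Gamma a) + Real.log a - a * Real.log a)
      + (Real.log (Real.Gamma b) + Real.log b - b * Real.log b)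
      ≤ 2 * (Real.log (Real.Gamma ((a + b) / 2)) + Real.log ((a + b) / 2)
        - (a + b) / 2 * Real.log ((a + b) / 2)) := by
  have lim : ∀ x : ℝ, 0 < x → Tendsto (fun n => Real.BohrMollerup.logGammaSeq x n + Real.log x
      - x * Real.log x) atTop (𝓝 (Real.log (Real.Gamma x) + Real.log x - x * Real.log x)) :=
    fun x hx => ((Real.BohrMollerup.tendsto_log_gamma hx).add_const _).sub_const _
  refine le_of_tendsto_of_tendsto ((lim a ha).add (lim b hb))
    ((lim ((a + b) / 2) (by positivity)).const_mul 2) (Eventually.of_forall fun n => ?_)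
  simp only [logGammaSeq_add_log_sub]
  have h1 := mul_log_add_ge (x := a + n) (y := b + n) (by positivity) (by positivity)
  have h2 : (∑ m ∈ Finset.range n, (a + m) * (Real.log (a + m + 1) - Real.log (a + m)))
      + ∑ m ∈ Finset.range n, (b + m) * (Real.log (b + m + 1) - Real.log (b + m))
      ≤ 2 * ∑ m ∈ Finset.range n, ((a + b) / 2 + m)
        * (Real.log ((a + b) / 2 + m + 1) - Real.log ((a + b) / 2 + m)) := by
    rw [← Finset.sum_add_distrib, Finset.mul_sum]
    refine Finset.sum_le_sum fun m _ => ?_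
    have := mul_log_succ_sub_log_add_le (x := a + m) (y := b + m) (by positivity) (by positivity)
    rwa [show (a + m + (b + m)) / 2 = (a + b) / 2 + m by ring] at this
  rw [show (a + n + (b + n)) / 2 = (a + b) / 2 + n by ring] at h1
  linarith

theorem Gamma_mul_Gamma_le {a b : ℝ} (ha : 0 < a) (hb : 0 < b) :
    Real.Gamma (1 + a) * Real.Gamma (1 + b) * ((a + b) / 2) ^ (a + b)
      ≤ Real.Gamma (1 + (a + b) / 2) ^ 2 * (a ^ a * b ^ b) := by
  have hc : 0 < (a + b) / 2 := by positivity
  have hG : ∀ x : ℝ, 0 < x → Real.log (Real.Gamma (1 + x)) = Real.log (Real.Gamma x) + Real.log x :=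
    fun x hx => by
      rw [add_comm, Real.Gamma_add_one hx.ne', Real.log_mul hx.ne' (Real.Gamma_pos_of_pos hx).ne',
        add_comm]
  have hp : ∀ x : ℝ, 0 < x → 0 < Real.Gamma (1 + x) := fun x hx =>
    Real.Gamma_pos_of_pos (by positivity)
  have h := log_Gamma_midpoint ha hb
  rw [← hG a ha, ← hG b hb, ← hG _ hc] at h
  have pa := hp a ha
  have pb := hp b hb
  have pc := hp _ hc
  refine (Real.log_le_log_iff (by positivity) (by positivity)).1 ?_
  rw [Real.log_mul (by positivity) (by positivity), Real.log_mul pa.ne' pb.ne',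
    Real.log_mul (by positivity) (by positivity), Real.log_mul (by positivity) (by positivity),
    Real.log_pow, Real.log_rpow ha, Real.log_rpow hb, Real.log_rpow hc]
  push_cast
  linarith

/-! ### Parseval's identity -/

section Parseval

open FourierTransform in
-- The `L²` transform and the Fourier integral are the same tempered distribution: against a smooth
-- compactly supported test function, the transform moves onto the test function on both sides.
theorem fourier_toLp_ae_eq {f : ℝ → ℂ} (h1 : Integrable f) (h2 : MemLp f 2) :
    (𝓕 (h2.toLp f) : Lp ℂ 2 (volume : Measure ℝ)) =ᵐ[volume] 𝓕 f := by
  have hcont : Continuous (𝓕 f) :=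
    VectorFourier.fourierIntegral_continuous Real.continuous_fourierChar
      (by exact continuous_inner) h1
  refine ae_eq_of_integral_contDiff_smul_eq
    ((Lp.memLp _).locallyIntegrable (by norm_num)) hcont.locallyIntegrable fun g hg hgc => ?_
  have hg1 : HasCompactSupport (fun x => (g x : ℂ)) := hgc.comp_left (g := Complex.ofReal) rfl
  have hg2 : ContDiff ℝ (⊤ : ℕ∞) (fun x => (g x : ℂ)) := Complex.ofRealCLM.contDiff.comp hg
  let G : SchwartzMap ℝ ℂ := hg1.toSchwartzMap hg2
  have hG : ∀ x, G x = (g x : ℂ) := fun x => rfl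
  have e1 := congrArg (fun T => T G) (Lp.fourier_toTemperedDistribution_eq (h2.toLp f))
  simp only [TemperedDistribution.fourier_apply, Lp.toTemperedDistribution_apply, hG] at e1
  have e2 : ∫ x, g x • (𝓕 (h2.toLp f) : Lp ℂ 2 (volume : Measure ℝ)) x
      = ∫ x, (g x : ℂ) • (𝓕 (h2.toLp f) : Lp ℂ 2 (volume : Measure ℝ)) x := by simp
  have e3 : ∫ x, g x • 𝓕 f x = ∫ x, G x • 𝓕 f x := by simp [hG]
  rw [e2, ← e1, e3]
  have e4 : ∫ x, (𝓕 G) x • f x = ∫ x, G x • 𝓕 f x := by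
    simpa using! VectorFourier.integral_fourierIntegral_smul_eq_flip (L := innerₗ ℝ)
      Real.continuous_fourierChar continuous_inner G.integrable h1
  rw [← e4]
  refine integral_congr_ae ?_
  filter_upwards [h2.coeFn_toLp] with x hx
  rw [hx]

/-- Lebesgue measure on `(0, ∞)`. -/
abbrev halfLine : Measure ℝ := volume.restrict (Ioi 0)

/-- The Fourier integral `s ↦ ∫₀^∞ e^{its} f(t) dt`. -/
def fourierHalf (f : ℝ → ℂ) (s : ℝ) : ℂ :=
  ∫ t : ℝ in Ioi 0, Complex.exp (t * s * Complex.I) * f t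

open FourierTransform in
theorem fourierHalf_eq (f : ℝ → ℂ) (s : ℝ) :
    fourierHalf f s = 𝓕 ((Ioi 0).indicator f) (-(2 * Real.pi)⁻¹ * s) := by
  rw [Real.fourier_real_eq_integral_exp_smul, fourierHalf, ← integral_indicator measurableSet_Ioi]
  refine integral_congr_ae (Eventually.of_forall fun t => ?_)
  simp only [indicator_apply]
  split_ifs
  · rw [smul_eq_mul]
    congr 2
    push_cast
    have : (Real.pi : ℂ) ≠ 0 := by exact_mod_cast Real.pi_ne_zero
    field_simp
  · simp

variable {f g : ℝ → ℂ}

theorem integrable_exp_mul (hf : Integrable f halfLine) (s : ℝ) :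
    Integrable (fun t : ℝ => Complex.exp (t * s * Complex.I) * f t) halfLine := by
  refine hf.bdd_mul (c := 1) (by fun_prop) (Eventually.of_forall fun t => ?_)
  rw [← Complex.ofReal_mul, Complex.norm_exp_ofReal_mul_I]

open FourierTransform in
theorem memLp_fourierHalf (hf1 : Integrable f halfLine) (hf2 : MemLp f 2 halfLine) :
    MemLp (fourierHalf f) 2 := by
  have h1 := (integrable_indicator_iff measurableSet_Ioi).2 hf1
  have h2 := (memLp_indicator_iff_restrict measurableSet_Ioi).2 hf2
  have h3 : MemLp (𝓕 ((Ioi 0).indicator f)) 2 :=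
    (memLp_congr_ae (fourier_toLp_ae_eq h1 h2)).1 (Lp.memLp _)
  have hcont : Continuous (𝓕 ((Ioi 0).indicator f)) :=
    VectorFourier.fourierIntegral_continuous Real.continuous_fourierChar
      (by exact continuous_inner) h1
  have e : fourierHalf f = fun s => 𝓕 ((Ioi 0).indicator f) (-(2 * Real.pi)⁻¹ * s) :=
    funext (fourierHalf_eq f)
  rw [e]
  have hm : AEStronglyMeasurable (fun s => 𝓕 ((Ioi 0).indicator f) (-(2 * Real.pi)⁻¹ * s)) :=
    (hcont.comp (continuous_const.mul continuous_id)).aestronglyMeasurable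
  rw [memLp_two_iff_integrable_sq_norm hm]
  exact ((memLp_two_iff_integrable_sq_norm hcont.aestronglyMeasurable).1 h3).comp_mul_left'
    (by simp [Real.pi_ne_zero])

open FourierTransform in
theorem integral_inner_fourierHalf (hf1 : Integrable f halfLine) (hf2 : MemLp f 2 halfLine)
    (hg1 : Integrable g halfLine) (hg2 : MemLp g 2 halfLine) :
    ∫ s, inner ℂ (fourierHalf f s) (fourierHalf g s)
      = 2 * Real.pi * ∫ t in Ioi 0, inner ℂ (f t) (g t) := by
  have f1 := (integrable_indicator_iff measurableSet_Ioi).2 hf1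
  have f2 := (memLp_indicator_iff_restrict measurableSet_Ioi).2 hf2
  have g1 := (integrable_indicator_iff measurableSet_Ioi).2 hg1
  have g2 := (memLp_indicator_iff_restrict measurableSet_Ioi).2 hg2
  have key := Lp.inner_fourier_eq (f2.toLp _) (g2.toLp _)
  rw [L2.inner_def, L2.inner_def] at key
  have e1 : ∫ x, inner ℂ (𝓕 ((Ioi 0).indicator f) x) (𝓕 ((Ioi 0).indicator g) x)
      = ∫ t in Ioi 0, inner ℂ (f t) (g t) := by
    rw [← integral_indicator measurableSet_Ioi]
    convert key using 1
    · refine integral_congr_ae ?_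
      filter_upwards [fourier_toLp_ae_eq f1 f2, fourier_toLp_ae_eq g1 g2] with x hx hy
      rw [hx, hy]
    · refine integral_congr_ae ?_
      filter_upwards [f2.coeFn_toLp, g2.coeFn_toLp] with x hx hy
      rw [hx, hy]
      simp only [indicator_apply]
      split_ifs <;> simp
  simp only [fourierHalf_eq]
  rw [Measure.integral_comp_mul_left (fun x => inner ℂ (𝓕 ((Ioi 0).indicator f) x)
    (𝓕 ((Ioi 0).indicator g) x)), e1]
  -- The Jacobian of the rescaling from `e^(-2πixξ)` to `e^(its)`; it is the `2π` in Parseval's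
  -- identity.
  have : |(-(2 * Real.pi)⁻¹)⁻¹| = 2 * Real.pi := by
    rw [inv_neg, inv_inv, abs_neg, abs_of_pos (by positivity)]
  rw [this, Complex.real_smul]
  push_cast
  rfl

theorem lintegral_enorm_sq_eq_ofReal {X : Type*} [MeasurableSpace X] {μ : Measure X} {F : X → ℂ}
    (hF : MemLp F 2 μ) : ∫⁻ x, ‖F x‖ₑ ^ 2 ∂μ = ENNReal.ofReal (∫ x, ‖F x‖ ^ 2 ∂μ) := by
  rw [ofReal_integral_eq_lintegral_ofReal
    ((memLp_two_iff_integrable_sq_norm hF.1).1 hF) (Eventually.of_forall fun x => by positivity)]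
  refine lintegral_congr fun x => ?_
  rw [ENNReal.ofReal_pow (norm_nonneg _), ofReal_norm]

theorem lintegral_fourierHalf (hf1 : Integrable f halfLine) (hf2 : MemLp f 2 halfLine) :
    ∫⁻ s, ‖fourierHalf f s‖ₑ ^ 2
      = ENNReal.ofReal (2 * Real.pi) * ∫⁻ t in Ioi 0, ‖f t‖ₑ ^ 2 := by
  rw [lintegral_enorm_sq_eq_ofReal (memLp_fourierHalf hf1 hf2), lintegral_enorm_sq_eq_ofReal hf2,
    ← ENNReal.ofReal_mul (by positivity)]
  congr 1
  have h := integral_inner_fourierHalf hf1 hf2 hf1 hf2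
  simp only [inner_self_eq_norm_sq_to_K] at h
  have e : ∀ {X : Type} [MeasurableSpace X] (μ : Measure X) (F : X → ℂ),
      ∫ x, ((‖F x‖ : ℂ)) ^ 2 ∂μ = ((∫ x, ‖F x‖ ^ 2 ∂μ : ℝ) : ℂ) := fun μ F => by
    rw [← integral_complex_ofReal]
    push_cast
    rfl
  have h' := (e _ _).symm.trans (h.trans (congrArg _ (e _ _)))
  exact_mod_cast h'

theorem fourierHalf_congr (h : f =ᵐ[halfLine] g) (s : ℝ) : fourierHalf f s = fourierHalf g s := by
  refine integral_congr_ae ?_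
  filter_upwards [h] with t ht
  rw [ht]

theorem fourierHalf_add (hf : Integrable f halfLine) (hg : Integrable g halfLine) (s : ℝ) :
    fourierHalf (fun t => f t + g t) s = fourierHalf f s + fourierHalf g s := by
  simp only [fourierHalf, mul_add]
  exact integral_add (integrable_exp_mul hf s) (integrable_exp_mul hg s)

theorem fourierHalf_const_mul (c : ℂ) (f : ℝ → ℂ) (s : ℝ) :
    fourierHalf (fun t => c * f t) s = c * fourierHalf f s := by
  simp only [fourierHalf, mul_left_comm _ c]
  exact integral_const_mul _ _

end Parseval

/-! ### The measure `σ` in the coordinates `(s, α, θ)` -/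

/-- The measure `α^{γ-1} dα` on `(0, ∞)`. -/
def radial (γ : ℝ) : Measure ℝ := halfLine.withDensity fun α => ENNReal.ofReal (α ^ (γ - 1))

instance (γ : ℝ) : SigmaFinite (radial γ) :=
  SigmaFinite.withDensity_of_ne_top' (fun _ => ENNReal.ofReal_ne_top)

/-- Lebesgue measure on `[0, 2π)`. -/
abbrev angular : Measure ℝ := volume.restrict (Ico 0 (2 * Real.pi))

theorem ae_radial_pos (γ : ℝ) : ∀ᵐ α ∂radial γ, 0 < α :=
  (withDensity_absolutelyContinuous _ _).ae_le (ae_restrict_mem measurableSet_Ioi)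

theorem continuous_chart {γ : ℝ} (hγ : 0 < γ) : Continuous (chart γ) := by
  unfold chart
  have : Continuous fun p : ℝ × ℝ × ℝ => |p.2.1| ^ γ :=
    (continuous_abs.comp (continuous_fst.comp continuous_snd)).rpow_const
      fun _ => Or.inr hγ.le
  fun_prop

theorem measurable_param {γ : ℝ} (hγ : 0 < γ) : Measurable (param γ) :=
  (continuous_chart hγ).measurable.subtype_mk

theorem withDensity_params_eq (γ : ℝ) :
    (volume.restrict params).withDensity (fun p => ENNReal.ofReal (p.2.1 ^ (γ - 1)))
      = (volume : Measure ℝ).prod ((radial γ).prod angular) := by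
  have h1 : (volume.restrict params : Measure (ℝ × ℝ × ℝ))
      = (volume : Measure ℝ).prod (halfLine.prod angular) := by
    rw [params, Measure.volume_eq_prod, ← Measure.prod_restrict, Measure.restrict_univ,
      Measure.volume_eq_prod, ← Measure.prod_restrict]
  have hm : Measurable fun α : ℝ => ENNReal.ofReal (α ^ (γ - 1)) := by fun_prop
  rw [h1, radial, prod_withDensity_left hm]
  exact (prod_withDensity_right (g := fun p : ℝ × ℝ => ENNReal.ofReal (p.1 ^ (γ - 1)))
    (by fun_prop)).symm

theorem sigma_eq (γ : ℝ) :
    sigma γ = Measure.map (param γ) ((volume : Measure ℝ).prod ((radial γ).prod angular)) := by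
  rw [sigma, withDensity_params_eq]

/-- `radial γ` is carried by `(0, ∞)`, so the line `ζ₁ = 0` is null and can be ignored. -/
theorem ae_sigma_of_forall_param {γ : ℝ} (hγ : 0 < γ) {P : M γ → Prop}
    (hP : MeasurableSet {ζ | P ζ}) (h : ∀ s α θ, 0 < α → P (param γ (s, α, θ))) :
    ∀ᵐ ζ ∂sigma γ, P ζ := by
  rw [sigma_eq, ae_map_iff (measurable_param hγ).aemeasurable hP]
  have h1 : ∀ᵐ q ∂(radial γ).prod angular, 0 < q.1 :=
    Measure.quasiMeasurePreserving_fst.ae (ae_radial_pos γ)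
  have h2 : ∀ᵐ p ∂(volume : Measure ℝ).prod ((radial γ).prod angular), 0 < p.2.1 :=
    Measure.quasiMeasurePreserving_snd.ae h1
  filter_upwards [h2] with p hp
  exact h _ _ _ hp

theorem fst_param (γ s α θ : ℝ) :
    (param γ (s, α, θ) : ℂ × ℂ).1 = α * Complex.exp (θ * Complex.I) := rfl

theorem re_snd_param (γ s α θ : ℝ) : (param γ (s, α, θ) : ℂ × ℂ).2.re = s := by
  simp [param, chart]

theorem norm_fst_param (γ s θ : ℝ) {α : ℝ} (hα : 0 < α) :
    ‖(param γ (s, α, θ) : ℂ × ℂ).1‖ = α := by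
  rw [fst_param, norm_mul, Complex.norm_exp_ofReal_mul_I, mul_one, Complex.norm_real,
    Real.norm_of_nonneg hα.le]

theorem ae_fst_ne_zero {γ : ℝ} (hγ : 0 < γ) : ∀ᵐ ζ : M γ ∂sigma γ, 0 < ‖(ζ : ℂ × ℂ).1‖ := by
  refine ae_sigma_of_forall_param hγ (P := fun ζ : M γ => 0 < ‖(ζ : ℂ × ℂ).1‖) ?_ fun s α θ hα => by rwa [norm_fst_param _ _ _ hα]
  exact measurableSet_lt measurable_const (by fun_prop)

/-! ### Superpositions of exponentials on `M_γ` -/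

/-- Profiles `h(t, α)` for which `wave k h` is defined pointwise and square integrable. -/
structure Admissible (γ : ℝ) (h : ℝ → ℝ → ℂ) : Prop where
  measurable : Measurable (Function.uncurry h)
  integrable : ∀ α, 0 < α → Integrable (fun t => h t α) halfLine
  memLp_slice : ∀ α, 0 < α → MemLp (fun t => h t α) 2 halfLine
  memLp : MemLp (Function.uncurry h) 2 (halfLine.prod (radial γ))

/-- The function `(2π)⁻¹ e^{ikθ} ∫₀^∞ e^{its} h(t, α) dt` on `M_γ`. -/
def wave {γ : ℝ} (k : ℕ) (h : ℝ → ℝ → ℂ) (ζ : M γ) : ℂ :=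
  (2 * Real.pi : ℂ)⁻¹ * ((ζ : ℂ × ℂ).1 / ‖(ζ : ℂ × ℂ).1‖) ^ k *
    fourierHalf (fun t => h t ‖(ζ : ℂ × ℂ).1‖) (ζ : ℂ × ℂ).2.re

theorem wave_param {γ : ℝ} (k : ℕ) (h : ℝ → ℝ → ℂ) (s θ : ℝ) {α : ℝ} (hα : 0 < α) :
    wave k h (param γ (s, α, θ)) = (2 * Real.pi : ℂ)⁻¹ * Complex.exp (θ * Complex.I) ^ k *
      fourierHalf (fun t => h t α) s := by
  rw [wave, norm_fst_param _ _ _ hα, re_snd_param, fst_param, mul_div_cancel_left₀]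
  exact_mod_cast hα.ne'

theorem measurable_fourierHalf {h : ℝ → ℝ → ℂ} (hh : Measurable (Function.uncurry h)) :
    Measurable fun p : ℝ × ℝ => fourierHalf (fun t => h t p.2) p.1 := by
  have h1 : StronglyMeasurable fun q : (ℝ × ℝ) × ℝ =>
      Complex.exp (q.2 * q.1.1 * Complex.I) * h q.2 q.1.2 := by
    apply Measurable.stronglyMeasurable
    refine Measurable.mul (by fun_prop) ?_
    exact hh.comp (measurable_snd.prodMk (measurable_snd.comp measurable_fst))
  exact (h1.integral_prod_right' (ν := halfLine)).measurable

theorem measurable_wave {γ : ℝ} (k : ℕ) {h : ℝ → ℝ → ℂ} (hh : Measurable (Function.uncurry h)) :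
    Measurable (wave (γ := γ) k h) := by
  refine Measurable.mul (by fun_prop) ?_
  exact (measurable_fourierHalf hh).comp (g := fun p : ℝ × ℝ => fourierHalf (fun t => h t p.2) p.1)
    (f := fun ζ : M γ => ((ζ : ℂ × ℂ).2.re, ‖(ζ : ℂ × ℂ).1‖)) (by fun_prop)

/-- Parseval in `s` and the integral over `θ` contribute `2π` each, which the factor `(2π)⁻¹` of
`wave` cancels. With values in `[0, ∞]` no integrability is presupposed, so membership in `L²` can
be deduced from it. -/
theorem lintegral_wave {γ : ℝ} (hγ : 0 < γ) (k : ℕ) {h : ℝ → ℝ → ℂ} (hh : Admissible γ h) :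
    ∫⁻ ζ, ‖wave k h ζ‖ₑ ^ 2 ∂sigma γ
      = ∫⁻ p, ‖Function.uncurry h p‖ₑ ^ 2 ∂halfLine.prod (radial γ) := by
  have hm := measurable_wave (γ := γ) k hh.measurable
  have hF := measurable_fourierHalf hh.measurable
  rw [sigma_eq, lintegral_map (by fun_prop) (measurable_param hγ),
    lintegral_prod_symm' (fun p => ‖wave k h (param γ p)‖ₑ ^ 2)
      ((hm.comp (measurable_param hγ)).enorm.pow_const 2)]
  have h1 : ∀ᵐ q ∂(radial γ).prod angular,
      ∫⁻ s, ‖wave k h (param γ (s, q))‖ₑ ^ 2 = (ENNReal.ofReal (2 * Real.pi))⁻¹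
        * ∫⁻ t in Ioi 0, ‖h t q.1‖ₑ ^ 2 := by
    filter_upwards [Measure.quasiMeasurePreserving_fst.ae (ae_radial_pos γ)] with q hq
    obtain ⟨α, θ⟩ := q
    have hpi : ‖((2 * Real.pi : ℂ)⁻¹)‖ₑ = (ENNReal.ofReal (2 * Real.pi))⁻¹ := by
      rw [show (2 * Real.pi : ℂ)⁻¹ = ((2 * Real.pi)⁻¹ : ℝ) by push_cast; rfl, ← ofReal_norm,
        Complex.norm_real, Real.norm_of_nonneg (by positivity),
        ENNReal.ofReal_inv_of_pos (by positivity)]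
    have hexp : ‖Complex.exp (θ * Complex.I)‖ₑ = 1 := by
      rw [← ofReal_norm, Complex.norm_exp_ofReal_mul_I, ENNReal.ofReal_one]
    simp only [wave_param k h _ θ hq, enorm_mul, enorm_pow, hpi, hexp, one_pow, mul_one, mul_pow]
    rw [lintegral_const_mul' _ _ (by simp [Real.pi_pos]),
      lintegral_fourierHalf (hh.integrable α hq) (hh.memLp_slice α hq), ← mul_assoc]
    congr 1
    rw [sq, mul_assoc, ENNReal.inv_mul_cancel (by simp [Real.pi_pos]) ENNReal.ofReal_ne_top,
      mul_one]
  rw [lintegral_congr_ae h1]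
  have hG : Measurable fun α => ∫⁻ t in Ioi 0, ‖h t α‖ₑ ^ 2 :=
    Measurable.lintegral_prod_left' (f := fun p => ‖Function.uncurry h p‖ₑ ^ 2)
      (hh.measurable.enorm.pow_const 2)
  have hG' : Measurable fun q : ℝ × ℝ => ∫⁻ t in Ioi 0, ‖h t q.1‖ₑ ^ 2 := hG.comp measurable_fst
  rw [lintegral_const_mul _ hG', lintegral_prod _ hG'.aemeasurable,
    lintegral_prod_symm' _ (hh.measurable.enorm.pow_const 2)]
  simp only [lintegral_const, Measure.restrict_apply MeasurableSet.univ, univ_inter,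
    Real.volume_Ico, sub_zero]
  rw [lintegral_mul_const _ hG, mul_comm, mul_assoc, ENNReal.mul_inv_cancel
    (by simp [Real.pi_pos]) ENNReal.ofReal_ne_top, mul_one]
  rfl

theorem memLp_two_of_lintegral {X : Type*} [MeasurableSpace X] {μ : Measure X} {F : X → ℂ}
    (hF : AEStronglyMeasurable F μ) (h : ∫⁻ x, ‖F x‖ₑ ^ 2 ∂μ < ⊤) : MemLp F 2 μ := by
  refine ⟨hF, ?_⟩
  rw [eLpNorm_lt_top_iff_lintegral_rpow_enorm_lt_top (by norm_num) (by norm_num)]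
  simpa using h

theorem lintegral_lt_top_of_memLp_two {X : Type*} [MeasurableSpace X] {μ : Measure X} {F : X → ℂ}
    (hF : MemLp F 2 μ) : ∫⁻ x, ‖F x‖ₑ ^ 2 ∂μ < ⊤ := by
  have := hF.2
  rw [eLpNorm_lt_top_iff_lintegral_rpow_enorm_lt_top (by norm_num) (by norm_num)] at this
  simpa using this

theorem integrable_inner_of_memLp {X : Type*} [MeasurableSpace X] {μ : Measure X} {F G : X → ℂ}
    (hF : MemLp F 2 μ) (hG : MemLp G 2 μ) : Integrable (fun x => inner ℂ (F x) (G x)) μ :=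
  hG.integrable_mul (q := 2) hF.star

theorem memLp_wave {γ : ℝ} (hγ : 0 < γ) (k : ℕ) {h : ℝ → ℝ → ℂ} (hh : Admissible γ h) :
    MemLp (wave k h) 2 (sigma γ) := by
  refine memLp_two_of_lintegral (measurable_wave k hh.measurable).aestronglyMeasurable ?_
  rw [lintegral_wave hγ k hh]
  exact lintegral_lt_top_of_memLp_two hh.memLp

theorem integral_inner_exp_pow (k l : ℕ) :
    ∫ θ : ℝ, inner ℂ (Complex.exp (θ * Complex.I) ^ k) (Complex.exp (θ * Complex.I) ^ l) ∂angular
      = if k = l then (2 * Real.pi : ℂ) else 0 := by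
  have e : ∀ θ : ℝ, inner ℂ (Complex.exp (θ * Complex.I) ^ k) (Complex.exp (θ * Complex.I) ^ l)
      = Complex.exp ((((l : ℂ) - k) * Complex.I) * θ) := fun θ => by
    rw [RCLike.inner_apply, map_pow, ← Complex.exp_conj, ← Complex.exp_nat_mul,
      ← Complex.exp_nat_mul, ← Complex.exp_add]
    congr 1
    simp
    ring
  simp only [e]
  split_ifs with hkl
  · simp [hkl, Real.pi_pos.le]
  · have hne : ((l : ℂ) - k) * Complex.I ≠ 0 :=
      mul_ne_zero (sub_ne_zero.2 (Nat.cast_injective.ne (Ne.symm hkl))) Complex.I_ne_zero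
    rw [integral_Ico_eq_integral_Ioc, ← intervalIntegral.integral_of_le (by positivity),
      integral_exp_mul_complex hne]
    have : Complex.exp ((((l : ℂ) - k) * Complex.I) * ((2 * Real.pi : ℝ) : ℂ)) = 1 :=
      Complex.exp_eq_one_iff.2 ⟨l - k, by push_cast; ring⟩
    rw [this]
    simp

/-- The polarized form of `lintegral_wave`; Fubini is now available because both waves are in `L²`.
The case `k ≠ l` vanishes in the integral over `θ`. -/
theorem integral_inner_wave {γ : ℝ} (hγ : 0 < γ) (k l : ℕ) {h g : ℝ → ℝ → ℂ}
    (hh : Admissible γ h) (hg : Admissible γ g) :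
    ∫ ζ, inner ℂ (wave k h ζ) (wave l g ζ) ∂sigma γ
      = if k = l then ∫ p, inner ℂ (Function.uncurry h p) (Function.uncurry g p)
          ∂halfLine.prod (radial γ) else 0 := by
  have hint : Integrable (fun ζ => inner ℂ (wave k h ζ) (wave l g ζ)) (sigma γ) :=
    integrable_inner_of_memLp (memLp_wave hγ k hh) (memLp_wave hγ l hg)
  have hint2 : Integrable (fun p => inner ℂ (Function.uncurry h p) (Function.uncurry g p))
      (halfLine.prod (radial γ)) := integrable_inner_of_memLp hh.memLp hg.memLp
  rw [sigma_eq] at hint ⊢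
  rw [integral_map (measurable_param hγ).aemeasurable hint.aestronglyMeasurable,
    integral_prod_symm (fun p => inner ℂ (wave k h (param γ p)) (wave l g (param γ p)))
      (hint.comp_measurable (measurable_param hγ))]
  have h1 : ∀ᵐ q ∂(radial γ).prod angular,
      ∫ s, inner ℂ (wave k h (param γ (s, q))) (wave l g (param γ (s, q)))
        = ((2 * Real.pi : ℂ)⁻¹ * ∫ t in Ioi 0, inner ℂ (h t q.1) (g t q.1))
          * inner ℂ (Complex.exp (q.2 * Complex.I) ^ k) (Complex.exp (q.2 * Complex.I) ^ l) := by
    filter_upwards [Measure.quasiMeasurePreserving_fst.ae (ae_radial_pos γ)] with q hq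
    obtain ⟨α, θ⟩ := q
    have e : ∀ s, inner ℂ (wave k h (param γ (s, α, θ))) (wave l g (param γ (s, α, θ)))
        = ((2 * Real.pi : ℂ)⁻¹ ^ 2 * inner ℂ (Complex.exp (θ * Complex.I) ^ k)
          (Complex.exp (θ * Complex.I) ^ l))
          * inner ℂ (fourierHalf (fun t => h t α) s) (fourierHalf (fun t => g t α) s) := by
      intro s
      rw [wave_param k h _ θ hq, wave_param l g _ θ hq]
      simp only [RCLike.inner_apply, map_mul, map_inv₀, Complex.conj_ofReal, map_ofNat]
      ring
    simp only [e]
    rw [integral_const_mul, integral_inner_fourierHalf (hh.integrable α hq) (hh.memLp_slice α hq)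
      (hg.integrable α hq) (hg.memLp_slice α hq)]
    have : (Real.pi : ℂ) ≠ 0 := by exact_mod_cast Real.pi_ne_zero
    field_simp
  rw [integral_congr_ae h1, integral_prod_mul
    (fun α => (2 * Real.pi : ℂ)⁻¹ * ∫ t in Ioi 0, inner ℂ (h t α) (g t α))
    (fun θ : ℝ => inner ℂ (Complex.exp (θ * Complex.I) ^ k) (Complex.exp (θ * Complex.I) ^ l)),
    integral_inner_exp_pow]
  split_ifs
  · rw [integral_const_mul, integral_prod_symm _ hint2]
    have : (Real.pi : ℂ) ≠ 0 := by exact_mod_cast Real.pi_ne_zero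
    field_simp
    rfl
  · simp

/-! ### Normalized radial profiles -/

section Profile

theorem integral_radial (γ : ℝ) (F : ℝ → ℂ) :
    ∫ α, F α ∂radial γ = ∫ α in Ioi 0, ((α ^ (γ - 1) : ℝ) : ℂ) * F α := by
  rw [radial, integral_withDensity_eq_integral_toReal_smul (by fun_prop)
    (Eventually.of_forall fun _ => ENNReal.ofReal_lt_top)]
  refine setIntegral_congr_fun measurableSet_Ioi fun α hα => ?_
  rw [ENNReal.toReal_ofReal (Real.rpow_nonneg (le_of_lt hα) _), Complex.real_smul]

theorem integrable_radial_iff (γ : ℝ) (F : ℝ → ℝ) :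
    Integrable F (radial γ) ↔ IntegrableOn (fun α => α ^ (γ - 1) * F α) (Ioi 0) := by
  rw [radial, integrable_withDensity_iff_integrable_smul' (by fun_prop)
    (Eventually.of_forall fun _ => ENNReal.ofReal_lt_top)]
  refine integrableOn_congr_fun (fun α hα => ?_) measurableSet_Ioi
  rw [ENNReal.toReal_ofReal (Real.rpow_nonneg (le_of_lt hα) _), smul_eq_mul]

/-- The exponent of `t` that makes the norm of `profile γ m b t` independent of `t`. -/
def profileExp (γ m : ℝ) : ℝ := (2 * m + γ) / (2 * γ)

/-- With `p = profileExp γ m`, the integral of `α^(2m+γ-1) e^(-2tbα^γ)` is `Γ(2p) / (γ (2tb)^(2p))`;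
this constant and `t^p` normalize it. -/
def profileConst (γ m b : ℝ) : ℝ :=
  √(γ * (2 * b) ^ (2 * profileExp γ m) / Real.Gamma (2 * profileExp γ m))

/-- The function `α ↦ α^m e^{-tbα^γ}`, normalized in `L²(α^{γ-1} dα)`. -/
def profile (γ m b t α : ℝ) : ℝ :=
  profileConst γ m b * t ^ profileExp γ m * α ^ m * Real.exp (-(t * b * α ^ γ))

/-- The inner product of two profiles; it does not depend on `t`. -/
def overlap (γ m b m' b' : ℝ) : ℝ :=
  profileConst γ m b * profileConst γ m' b' * Real.Gamma (profileExp γ m + profileExp γ m')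
    / (γ * (b + b') ^ (profileExp γ m + profileExp γ m'))

variable {γ m b m' b' : ℝ}

theorem profileExp_pos (hγ : 0 < γ) (hm : 0 ≤ m) : 0 < profileExp γ m := by
  unfold profileExp; positivity

theorem profileConst_pos (hγ : 0 < γ) (hm : 0 ≤ m) (hb : 0 < b) : 0 < profileConst γ m b := by
  have := profileExp_pos hγ hm
  have := Real.Gamma_pos_of_pos (s := 2 * profileExp γ m) (by positivity)
  unfold profileConst
  positivity

theorem profile_mul_profile {t α : ℝ} (ht : 0 < t) (hα : 0 < α) :
    α ^ (γ - 1) * (profile γ m b t α * profile γ m' b' t α)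
      = profileConst γ m b * profileConst γ m' b' * t ^ (profileExp γ m + profileExp γ m')
        * (α ^ (m + m' + γ - 1) * Real.exp (-(t * (b + b')) * α ^ γ)) := by
  rw [profile, profile, Real.rpow_add ht, show m + m' + γ - 1 = m + m' + (γ - 1) by ring,
    Real.rpow_add hα, Real.rpow_add hα,
    show -(t * (b + b')) * α ^ γ = -(t * b * α ^ γ) + -(t * b' * α ^ γ) by ring, Real.exp_add]
  ring

theorem integrable_profile_mul (hγ : 0 < γ) (hm : 0 ≤ m) (hb : 0 < b) (hm' : 0 ≤ m')
    (hb' : 0 < b') {t : ℝ} (ht : 0 < t) :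
    Integrable (fun α => profile γ m b t α * profile γ m' b' t α) (radial γ) := by
  rw [integrable_radial_iff]
  refine IntegrableOn.congr_fun ?_ (fun α hα => (profile_mul_profile ht hα).symm)
    measurableSet_Ioi
  exact (integrableOn_rpow_mul_exp_neg_mul_rpow (by linarith) hγ (by positivity)).const_mul _

/-- The Gamma integral produces `(t(b+b'))` to the power `-(p+p')`, and its power of `t` cancels
`t^p t^p'`. -/
theorem integral_profile_mul (hγ : 0 < γ) (hm : 0 ≤ m) (hb : 0 < b) (hm' : 0 ≤ m')
    (hb' : 0 < b') {t : ℝ} (ht : 0 < t) :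
    ∫ α, (profile γ m b t α : ℂ) * profile γ m' b' t α ∂radial γ = overlap γ m b m' b' := by
  have e : ∫ α in Ioi 0, ((α ^ (γ - 1) : ℝ) : ℂ) * (profile γ m b t α * profile γ m' b' t α)
      = ((∫ α in Ioi 0, profileConst γ m b * profileConst γ m' b'
        * t ^ (profileExp γ m + profileExp γ m')
        * (α ^ (m + m' + γ - 1) * Real.exp (-(t * (b + b')) * α ^ γ)) : ℝ) : ℂ) := by
    rw [← integral_complex_ofReal]
    refine setIntegral_congr_fun measurableSet_Ioi fun α hα => ?_
    rw [← profile_mul_profile ht hα]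
    push_cast
    rfl
  rw [integral_radial, e, integral_const_mul,
    integral_rpow_mul_exp_neg_mul_rpow hγ (by linarith) (by positivity), overlap]
  have h1 : (m + m' + γ - 1 + 1) / γ = profileExp γ m + profileExp γ m' := by
    unfold profileExp; field_simp; ring
  rw [neg_div, h1, Real.rpow_neg (by positivity), Real.mul_rpow ht.le (by positivity)]
  have h2 : t ^ (profileExp γ m + profileExp γ m') ≠ 0 := (Real.rpow_pos_of_pos ht _).ne'
  congr 1
  field_simp

theorem overlap_self (hγ : 0 < γ) (hm : 0 ≤ m) (hb : 0 < b) : overlap γ m b m b = 1 := by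
  have hp := profileExp_pos hγ hm
  have hG := Real.Gamma_pos_of_pos (s := 2 * profileExp γ m) (by positivity)
  rw [overlap, ← two_mul, ← two_mul, profileConst, Real.mul_self_sqrt (by positivity)]
  have : (2 * b) ^ (2 * profileExp γ m) ≠ 0 := (Real.rpow_pos_of_pos (by positivity) _).ne'
  field_simp

theorem measurable_profile (γ m b : ℝ) : Measurable (Function.uncurry (profile γ m b)) := by
  unfold profile Function.uncurry
  fun_prop

/-! ### Waves with a given radial profile -/

/-- The profile `h(t, α) = φ(t) u(t, α)`. -/
def profileMul (γ m b : ℝ) (φ : ℝ → ℂ) (t α : ℝ) : ℂ := φ t * profile γ m b t α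

/-- Raise `x ≤ e^x` at `x = tB/p` to the power `p`. -/
theorem rpow_mul_exp_le {p B t : ℝ} (hp : 0 < p) (hB : 0 < B) (ht : 0 < t) :
    t ^ p * Real.exp (-(t * B)) ≤ (p / B) ^ p := by
  have h1 : (t * B / p) ^ p ≤ Real.exp (t * B / p) ^ p :=
    Real.rpow_le_rpow (by positivity)
      ((le_add_of_nonneg_right zero_le_one).trans (Real.add_one_le_exp _)) hp.le
  rw [← Real.exp_mul, div_mul_cancel₀ _ hp.ne'] at h1
  have h2 : t ^ p = (p / B) ^ p * (t * B / p) ^ p := by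
    rw [← Real.mul_rpow (by positivity) (by positivity)]
    congr 1
    field_simp
  rw [h2, mul_assoc]
  have h3 : (t * B / p) ^ p * Real.exp (-(t * B)) ≤ 1 := by
    calc (t * B / p) ^ p * Real.exp (-(t * B)) ≤ Real.exp (t * B) * Real.exp (-(t * B)) := by gcongr
      _ = 1 := by rw [← Real.exp_add]; simp
  exact mul_le_of_le_one_right (by positivity) h3

theorem memLp_rpow_mul_exp {p B : ℝ} (hp : 0 < p) (hB : 0 < B) :
    MemLp (fun t : ℝ => t ^ p * Real.exp (-(t * B))) 2 halfLine := by
  rw [memLp_two_iff_integrable_sq (by fun_prop)]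
  refine IntegrableOn.congr_fun (integrableOn_rpow_mul_exp_neg_mul_rpow (p := 1) (s := 2 * p)
    (b := 2 * B) (by linarith) one_pos (by positivity)) (fun t ht => ?_) measurableSet_Ioi
  rw [mul_pow, ← Real.rpow_mul_natCast (le_of_lt ht), Real.rpow_one, sq (Real.exp _),
    ← Real.exp_add]
  congr 2
  · push_cast; ring
  · ring

/-- For fixed `α`, the factor `t^p e^(-tB)` is both square integrable and bounded, which gives
integrability and square integrability of the slice. Jointly, the profile has norm one for every
`t`, so the norm is that of `φ`. -/
theorem admissible_profileMul (hγ : 0 < γ) (hm : 0 ≤ m) (hb : 0 < b) {φ : ℝ → ℂ}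
    (hφ : Measurable φ) (hφ2 : MemLp φ 2 halfLine) : Admissible γ (profileMul γ m b φ) := by
  have hmeas : Measurable (Function.uncurry (profileMul γ m b φ)) :=
    (hφ.comp measurable_fst).mul (measurable_profile γ m b).complex_ofReal
  have hp := profileExp_pos hγ hm
  have key : ∀ α, 0 < α → ∀ t, profileMul γ m b φ t α = (profileConst γ m b * α ^ m : ℝ) *
      (φ t * ((t ^ profileExp γ m * Real.exp (-(t * (b * α ^ γ))) : ℝ) : ℂ)) := fun α hα t => by
    rw [profileMul, profile, mul_assoc t]
    push_cast
    ring
  refine ⟨hmeas, fun α hα => ?_, fun α hα => ?_, ?_⟩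
  · simp only [key α hα]
    exact (hφ2.integrable_mul (q := 2)
      (memLp_rpow_mul_exp hp (by positivity : 0 < b * α ^ γ)).ofReal).const_mul _
  · simp only [key α hα]
    refine MemLp.const_mul ?_ _
    refine MemLp.of_le_mul (c := (profileExp γ m / (b * α ^ γ)) ^ profileExp γ m) hφ2
      (by fun_prop) ?_
    filter_upwards [ae_restrict_mem measurableSet_Ioi] with t ht
    have ht : 0 < t := ht
    rw [norm_mul, mul_comm, Complex.norm_real, Real.norm_of_nonneg (by positivity)]
    gcongr
    exact rpow_mul_exp_le hp (by positivity) ht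
  · refine memLp_two_of_lintegral hmeas.aestronglyMeasurable ?_
    rw [lintegral_prod _ (hmeas.enorm.pow_const 2).aemeasurable]
    refine lt_of_le_of_lt (le_of_eq ?_) (lintegral_lt_top_of_memLp_two hφ2)
    refine setLIntegral_congr_fun measurableSet_Ioi fun t ht => ?_
    have hp2 : MemLp (fun α => (profile γ m b t α : ℂ)) 2 (radial γ) := by
      have hm1 : Measurable fun α => profile γ m b t α :=
        (measurable_profile γ m b).comp measurable_prodMk_left
      refine (memLp_two_iff_integrable_sq_norm hm1.complex_ofReal.aestronglyMeasurable).2 ?_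
      simp only [Complex.norm_real, Real.norm_eq_abs, sq_abs]
      simpa only [sq] using integrable_profile_mul hγ hm hb hm hb ht
    have e1 : ∫ α, ‖(profile γ m b t α : ℂ)‖ ^ 2 ∂radial γ = 1 := by
      have := integral_profile_mul hγ hm hb hm hb ht
      rw [overlap_self hγ hm hb] at this
      have h2 : ∫ α, (profile γ m b t α : ℂ) * profile γ m b t α ∂radial γ
          = ((∫ α, ‖(profile γ m b t α : ℂ)‖ ^ 2 ∂radial γ : ℝ) : ℂ) := by
        rw [← integral_complex_ofReal]
        simp [sq]
      exact_mod_cast h2.symm.trans this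
    simp only [Function.uncurry, profileMul, enorm_mul, mul_pow]
    rw [lintegral_const_mul' _ _ (by simp), lintegral_enorm_sq_eq_ofReal hp2, e1,
      ENNReal.ofReal_one, mul_one]

theorem integral_inner_profileMul (hγ : 0 < γ) (hm : 0 ≤ m) (hb : 0 < b) (hm' : 0 ≤ m')
    (hb' : 0 < b') {φ ψ : ℝ → ℂ} (hφ : Measurable φ) (hφ2 : MemLp φ 2 halfLine)
    (hψ : Measurable ψ) (hψ2 : MemLp ψ 2 halfLine) :
    ∫ p, inner ℂ (Function.uncurry (profileMul γ m b φ) p)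
        (Function.uncurry (profileMul γ m' b' ψ) p) ∂halfLine.prod (radial γ)
      = overlap γ m b m' b' * ∫ t in Ioi 0, inner ℂ (φ t) (ψ t) := by
  rw [integral_prod _ (integrable_inner_of_memLp (admissible_profileMul hγ hm hb hφ hφ2).memLp
    (admissible_profileMul hγ hm' hb' hψ hψ2).memLp), ← integral_const_mul]
  refine setIntegral_congr_fun measurableSet_Ioi fun t ht => ?_
  rw [← integral_profile_mul hγ hm hb hm' hb' ht, mul_comm, ← integral_const_mul]
  congr 1
  ext α
  simp only [Function.uncurry, profileMul, RCLike.inner_apply, map_mul, Complex.conj_ofReal]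
  ring

theorem wave_congr_ae {φ ψ : ℝ → ℂ} (h : φ =ᵐ[halfLine] ψ) (k : ℕ) (ζ : M γ) :
    wave k (profileMul γ m b φ) ζ = wave k (profileMul γ m b ψ) ζ := by
  rw [wave, wave]
  congr 1
  refine fourierHalf_congr ?_ _
  filter_upwards [h] with t ht
  rw [profileMul, profileMul, ht]

/-- `L²((0, ∞), dt)`. -/
abbrev HalfL2 : Type := Lp ℂ 2 halfLine

theorem measurable_coe_halfL2 (φ : HalfL2) : Measurable φ := (Lp.stronglyMeasurable φ).measurable

theorem memLp_wave_profileMul (hγ : 0 < γ) (hm : 0 ≤ m) (hb : 0 < b) (k : ℕ) (φ : HalfL2) :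
    MemLp (wave k (profileMul γ m b φ)) 2 (sigma γ) :=
  memLp_wave hγ k (admissible_profileMul hγ hm hb (measurable_coe_halfL2 φ) (Lp.memLp φ))

theorem inner_waveLp (hγ : 0 < γ) (hm : 0 ≤ m) (hb : 0 < b) (hm' : 0 ≤ m') (hb' : 0 < b')
    (k l : ℕ) (φ ψ : HalfL2) :
    inner ℂ ((memLp_wave_profileMul hγ hm hb k φ).toLp _)
      ((memLp_wave_profileMul hγ hm' hb' l ψ).toLp _)
      = if k = l then overlap γ m b m' b' * inner ℂ φ ψ else 0 := by
  rw [L2.inner_def, L2.inner_def, ← integral_inner_profileMul hγ hm hb hm' hb'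
    (measurable_coe_halfL2 φ) (Lp.memLp φ) (measurable_coe_halfL2 ψ) (Lp.memLp ψ),
    ← integral_inner_wave hγ k l
      (admissible_profileMul hγ hm hb (measurable_coe_halfL2 φ) (Lp.memLp φ))
      (admissible_profileMul hγ hm' hb' (measurable_coe_halfL2 ψ) (Lp.memLp ψ))]
  refine integral_congr_ae ?_
  filter_upwards [(memLp_wave_profileMul hγ hm hb k φ).coeFn_toLp,
    (memLp_wave_profileMul hγ hm' hb' l ψ).coeFn_toLp] with ζ h1 h2
  rw [h1, h2]

/-- The isometry `φ ↦ (2π)⁻¹ e^{ikθ} ∫₀^∞ e^{its} φ(t) u(t, α) dt` into `L²(M_γ, σ)`, where `u` is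
the normalized profile `α^m e^{-tbα^γ}`. -/
def waveLp (hγ : 0 < γ) (hm : 0 ≤ m) (hb : 0 < b) (k : ℕ) : HalfL2 →ₗᵢ[ℂ] Lp ℂ 2 (sigma γ) :=
  LinearMap.isometryOfInner
    { toFun := fun φ => (memLp_wave_profileMul hγ hm hb k φ).toLp _
      map_add' := fun φ ψ => by
        rw [← MemLp.toLp_add, MemLp.toLp_eq_toLp_iff]
        -- Splitting the Fourier integral needs integrable slices, which are known only for `α > 0`.
        filter_upwards [ae_fst_ne_zero hγ] with ζ hζ
        rw [wave_congr_ae (Lp.coeFn_add φ ψ), Pi.add_apply, wave, wave, wave, ← mul_add,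
          ← fourierHalf_add
            ((admissible_profileMul hγ hm hb (measurable_coe_halfL2 φ) (Lp.memLp φ)).integrable _ hζ)
            ((admissible_profileMul hγ hm hb (measurable_coe_halfL2 ψ) (Lp.memLp ψ)).integrable _ hζ)]
        simp only [profileMul, Pi.add_apply, add_mul]
      map_smul' := fun c φ => by
        rw [RingHom.id_apply, ← MemLp.toLp_const_smul, MemLp.toLp_eq_toLp_iff]
        refine Eventually.of_forall fun ζ => ?_
        have e : (fun t => profileMul γ m b (c • ⇑φ) t ‖(ζ : ℂ × ℂ).1‖)
            = fun t => c * profileMul γ m b φ t ‖(ζ : ℂ × ℂ).1‖ := by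
          ext t
          simp only [profileMul, Pi.smul_apply, smul_eq_mul, mul_assoc]
        rw [wave_congr_ae (Lp.coeFn_smul c φ), Pi.smul_apply, wave, wave, smul_eq_mul,
          mul_left_comm c, e, fourierHalf_const_mul] }
    (fun φ ψ => by
      have := inner_waveLp hγ hm hb hm hb k k φ ψ
      rwa [if_pos rfl, overlap_self hγ hm hb, Complex.ofReal_one, one_mul] at this)

theorem coeFn_waveLp (hγ : 0 < γ) (hm : 0 ≤ m) (hb : 0 < b) (k : ℕ) (φ : HalfL2) :
    waveLp hγ hm hb k φ =ᵐ[sigma γ] wave k (profileMul γ m b φ) :=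
  (memLp_wave_profileMul hγ hm hb k φ).coeFn_toLp

theorem inner_waveLp_waveLp (hγ : 0 < γ) (hm : 0 ≤ m) (hb : 0 < b) (hm' : 0 ≤ m') (hb' : 0 < b')
    (k l : ℕ) (φ ψ : HalfL2) :
    inner ℂ (waveLp hγ hm hb k φ) (waveLp hγ hm' hb' l ψ)
      = if k = l then overlap γ m b m' b' * inner ℂ φ ψ else 0 :=
  inner_waveLp hγ hm hb hm' hb' k l φ ψ

end Profile

/-! ### The norms of the components of the Leray transform -/

section Gain

/-- The norm of the `k`-th Fourier component of the Leray transform. -/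
def gain (γ : ℝ) (k : ℕ) : ℝ := (overlap γ ((γ - 1) * k) (γ - 1) k 1)⁻¹

variable {γ : ℝ}

/-- The power `t^(k+1)` of the Laplace integral of `Y^(-(k+2))`; it also turns the Gamma value in
the overlap into `k!`. -/
theorem profileExp_add (hγ : 0 < γ) (k : ℕ) :
    profileExp γ ((γ - 1) * k) + profileExp γ k = k + 1 := by
  unfold profileExp
  field_simp
  ring

theorem overlap_eq (hγ : 0 < γ) (k : ℕ) : overlap γ ((γ - 1) * k) (γ - 1) k 1
    = profileConst γ ((γ - 1) * k) (γ - 1) * profileConst γ k 1 * k.factorial / γ ^ (k + 2) := by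
  rw [overlap, profileExp_add hγ, Real.Gamma_nat_eq_factorial, sub_add_cancel,
    show (k : ℝ) + 1 = ((k + 1 : ℕ) : ℝ) by push_cast; rfl, Real.rpow_natCast, pow_succ' γ (k + 1)]

theorem overlap_pos (hγ : 1 < γ) (k : ℕ) : 0 < overlap γ ((γ - 1) * k) (γ - 1) k 1 := by
  have h1 : 0 < γ - 1 := by linarith
  have h2 := profileConst_pos (γ := γ) (m := (γ - 1) * k) (b := γ - 1) (by linarith)
    (by positivity) h1
  have h3 := profileConst_pos (γ := γ) (m := k) (b := 1) (by linarith) (by positivity) one_pos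
  rw [overlap_eq (by linarith)]
  positivity

theorem gain_pos (hγ : 1 < γ) (k : ℕ) : 0 < gain γ k := inv_pos.2 (overlap_pos hγ k)

/-- Matches the normalizing constants with the coefficient of the kernel expansion, so that the
factor in front of the normalized profiles is exactly the inverse overlap. -/
theorem gain_mul_const (hγ : 1 < γ) (k : ℕ) :
    gain γ k * profileConst γ k 1 * profileConst γ ((γ - 1) * k) (γ - 1)
      = γ ^ (k + 2) / k.factorial := by
  have h1 : 0 < γ - 1 := by linarith
  have h2 := profileConst_pos (γ := γ) (m := (γ - 1) * k) (b := γ - 1) (by linarith)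
    (by positivity) h1
  have h3 := profileConst_pos (γ := γ) (m := k) (b := 1) (by linarith) (by positivity) one_pos
  rw [gain, overlap_eq (by linarith)]
  field_simp

theorem sq_profileConst (hγ : 0 < γ) {m b : ℝ} (hm : 0 ≤ m) (hb : 0 < b) :
    profileConst γ m b ^ 2 = γ * (2 * b) ^ (2 * profileExp γ m)
      / Real.Gamma (2 * profileExp γ m) := by
  have hp := profileExp_pos hγ hm
  have hG := Real.Gamma_pos_of_pos (s := 2 * profileExp γ m) (by positivity)
  exact Real.sq_sqrt (by positivity)

theorem overlap_zero (hγ : 1 < γ) :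
    overlap γ ((γ - 1) * (0 : ℕ)) (γ - 1) (0 : ℕ) 1 = 2 * √(γ - 1) / γ := by
  have h1 : 0 < γ - 1 := by linarith
  have hγ0 : 0 < γ := by linarith
  have hp : 2 * profileExp γ 0 = 1 := by unfold profileExp; field_simp; ring
  rw [overlap_eq hγ0, Nat.cast_zero, mul_zero, profileConst, profileConst, hp, Real.rpow_one,
    Real.rpow_one, Real.Gamma_one, div_one, div_one, ← Real.sqrt_mul (by positivity),
    show γ * (2 * (γ - 1)) * (γ * (2 * 1)) = (2 * γ) ^ 2 * (γ - 1) by ring,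
    Real.sqrt_mul (by positivity), Real.sqrt_sq (by positivity)]
  simp only [Nat.factorial_zero, Nat.cast_one]
  field_simp

theorem gain_zero (hγ : 1 < γ) : gain γ 0 = γ / (2 * √(γ - 1)) := by
  rw [gain, overlap_zero hγ, inv_div]

/-- Put `a = 2k/γ` and `b = (γ-1)a`, so that `a + b = 2k`. Squared, the claim is `Γ(1+a) Γ(1+b) ≤
k!² 2^(2k) (γ-1)^b / γ^(2k)`, which is `Gamma_mul_Gamma_le` divided by `k^(2k)`. The case `k = 0` is
apart since `a` and `b` must be positive. -/
theorem gain_le (hγ : 1 < γ) (k : ℕ) : gain γ k ≤ gain γ 0 := by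
  rcases Nat.eq_zero_or_pos k with rfl | hk
  · rfl
  have h1 : 0 < γ - 1 := by linarith
  have hγ0 : 0 < γ := by linarith
  have hk0 : (0 : ℝ) < k := by exact_mod_cast hk
  refine inv_anti₀ (overlap_pos hγ 0) (le_of_sq_le_sq ?_ (overlap_pos hγ k).le)
  rw [overlap_zero hγ, overlap_eq hγ0, div_pow, div_pow, mul_pow, mul_pow, mul_pow,
    Real.sq_sqrt h1.le, sq_profileConst hγ0 (by positivity) h1,
    sq_profileConst hγ0 (by positivity) one_pos]
  obtain ⟨a, ha⟩ : ∃ a : ℝ, a = k * (2 / γ) := ⟨_, rfl⟩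
  obtain ⟨b, hb⟩ : ∃ b : ℝ, b = k * (2 / γ) * (γ - 1) := ⟨_, rfl⟩
  have ha0 : 0 < a := by rw [ha]; positivity
  have hb0 : 0 < b := by rw [hb]; positivity
  have e1 : 2 * profileExp γ ((γ - 1) * k) = 1 + b := by
    rw [hb]; unfold profileExp; field_simp; ring
  have e2 : 2 * profileExp γ k = 1 + a := by rw [ha]; unfold profileExp; field_simp; ring
  have hab : a + b = 2 * k := by rw [ha, hb]; field_simp; ring
  have hΓ := Gamma_mul_Gamma_le ha0 hb0
  have hk1 : Real.Gamma (1 + k) = k.factorial := by rw [add_comm, Real.Gamma_nat_eq_factorial]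
  rw [show (a + b) / 2 = k by rw [hab]; ring, hk1, Real.rpow_add hk0] at hΓ
  have e3 : a ^ a * b ^ b = (k : ℝ) ^ a * (k : ℝ) ^ b * (2 ^ a * 2 ^ b * (γ - 1) ^ b / γ ^ (2 * k)) := by
    have : γ ^ (2 * k) = γ ^ a * γ ^ b := by
      rw [← Real.rpow_add hγ0, hab, ← Real.rpow_natCast]; push_cast; rfl
    rw [this]
    have ea : a ^ a = (k : ℝ) ^ a * (2 ^ a / γ ^ a) := by
      rw [← Real.div_rpow (by positivity) (by positivity),
        ← Real.mul_rpow (by positivity) (by positivity), ← ha]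
    have eb : b ^ b = (k : ℝ) ^ b * (2 ^ b / γ ^ b) * (γ - 1) ^ b := by
      rw [← Real.div_rpow (by positivity) (by positivity),
        ← Real.mul_rpow (by positivity) (by positivity),
        ← Real.mul_rpow (by positivity) (by positivity), ← hb]
    rw [ea, eb]
    field_simp
  have pka : 0 < (k : ℝ) ^ a * (k : ℝ) ^ b := by positivity
  have pa : 0 < Real.Gamma (1 + a) := Real.Gamma_pos_of_pos (by positivity)
  have pb : 0 < Real.Gamma (1 + b) := Real.Gamma_pos_of_pos (by positivity)
  have hΓ2 : Real.Gamma (1 + a) * Real.Gamma (1 + b)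
      ≤ (k.factorial : ℝ) ^ 2 * (2 ^ a * 2 ^ b * (γ - 1) ^ b / γ ^ (2 * k)) := by
    rw [e3] at hΓ
    refine le_of_mul_le_mul_right (hΓ.trans (le_of_eq ?_)) pka
    ring
  rw [e1, e2, mul_one, Real.rpow_add (by positivity), Real.rpow_add (by positivity),
    Real.rpow_one, Real.rpow_one, Real.mul_rpow (by positivity) h1.le]
  have e4 : (γ ^ (k + 2)) ^ 2 = γ ^ (2 * k) * γ ^ 2 * γ ^ 2 := by ring
  rw [e4]
  have e5 : γ * (2 * (γ - 1) * (2 ^ b * (γ - 1) ^ b)) / Real.Gamma (1 + b)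
        * (γ * (2 * 2 ^ a) / Real.Gamma (1 + a)) * (k.factorial : ℝ) ^ 2
        / (γ ^ (2 * k) * γ ^ 2 * γ ^ 2)
      = 2 ^ 2 * (γ - 1) / γ ^ 2 * ((k.factorial : ℝ) ^ 2 * (2 ^ a * 2 ^ b * (γ - 1) ^ b / γ ^ (2 * k))
        / (Real.Gamma (1 + a) * Real.Gamma (1 + b))) := by
    field_simp
  rw [e5]
  exact le_mul_of_one_le_right (by positivity) ((one_le_div (by positivity)).2 hΓ2)

end Gain

/-! ### The Leray kernel of `M_γ` -/

section Kernel

variable {γ : ℝ}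

open ComplexConjugate

/-- Twice the denominator `⟨∂ρ(ζ), ζ - z⟩` of the Leray kernel. -/
def denom (γ : ℝ) (z ζ : ℂ × ℂ) : ℂ :=
  γ * (‖ζ.1‖ ^ (γ - 2) : ℝ) * conj ζ.1 * (ζ.1 - z.1) + Complex.I * (ζ.2 - z.2)

/-- The density of the Leray kernel with respect to `σ`. -/
def density (γ : ℝ) (z ζ : ℂ × ℂ) : ℂ := γ ^ 2 / (4 * Real.pi ^ 2) / denom γ z ζ ^ 2

theorem hasFDerivAt_rho (hγ : 1 < γ) (ξ : ℂ × ℂ) :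
    HasFDerivAt (rho γ) (((γ * ‖ξ.1‖ ^ (γ - 2)) • innerSL ℝ ξ.1).comp (ContinuousLinearMap.fst ℝ ℂ ℂ)
      - Complex.imCLM.comp (ContinuousLinearMap.snd ℝ ℂ ℂ)) ξ := by
  have h1 := (hasFDerivAt_norm_rpow ξ.1 hγ).comp ξ (hasFDerivAt_fst (𝕜 := ℝ) (p := ξ))
  have h2 := Complex.imCLM.hasFDerivAt.comp ξ (hasFDerivAt_snd (𝕜 := ℝ) (p := ξ))
  exact h1.sub h2

theorem del_rho (hγ : 1 < γ) (ξ w : ℂ × ℂ) :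
    del (fun ξ => (rho γ ξ : ℂ)) ξ w
      = (γ * (‖ξ.1‖ ^ (γ - 2) : ℝ) * conj ξ.1 * w.1 + Complex.I * w.2) / 2 := by
  have h := Complex.ofRealCLM.hasFDerivAt.comp ξ (hasFDerivAt_rho hγ ξ)
  have e : fderiv ℝ (fun ξ => (rho γ ξ : ℂ)) ξ = _ := h.fderiv
  rw [del, e]
  apply Complex.ext <;> simp [Complex.inner] <;> ring

/-- Needed for `q = γ - 2`, which may be negative; differentiate `(‖x‖²)^(q/2)` away from `0`. -/
theorem hasFDerivAt_norm_rpow_of_ne_zero (q : ℝ) {x : ℂ} (hx : x ≠ 0) :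
    HasFDerivAt (fun x : ℂ => ‖x‖ ^ q) ((q * ‖x‖ ^ (q - 2)) • innerSL ℝ x) x := by
  have h1 := (hasStrictFDerivAt_norm_sq x).hasFDerivAt.rpow_const (p := q / 2)
    (Or.inl (by positivity))
  have e : (fun x : ℂ => (‖x‖ ^ 2) ^ (q / 2)) = fun x => ‖x‖ ^ q := by
    ext y
    rw [← Real.rpow_natCast, ← Real.rpow_mul (norm_nonneg _)]
    congr 1
    push_cast
    ring
  rw [e] at h1
  refine h1.congr_fderiv ?_
  rw [← Real.rpow_natCast, ← Real.rpow_mul (norm_nonneg _), ← Nat.cast_smul_eq_nsmul ℝ, smul_smul]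
  congr 1
  rw [show ((2 : ℕ) : ℝ) * (q / 2 - 1) = q - 2 by push_cast; ring]
  push_cast
  ring

/-- `∂²|z₁|^γ/∂z̄₁∂z₁ = (γ²/4)|z₁|^(γ-2)`, and `Im z₂` is pluriharmonic. -/
theorem delBar_del_rho (hγ : 1 < γ) {ξ : ℂ × ℂ} (hξ : ξ.1 ≠ 0) (v w : ℂ × ℂ) :
    delBar (fun ξ => del (fun ξ => (rho γ ξ : ℂ)) ξ w) ξ v
      = γ ^ 2 / 4 * (‖ξ.1‖ ^ (γ - 2) : ℝ) * (w.1 * conj v.1) := by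
  have e0 : (fun ξ => del (fun ξ => (rho γ ξ : ℂ)) ξ w) = fun ξ =>
      (γ * (‖ξ.1‖ ^ (γ - 2) : ℝ) * conj ξ.1 * w.1 + Complex.I * w.2) / 2 :=
    funext fun ξ => del_rho hγ ξ w
  have h1 : HasFDerivAt (fun ξ : ℂ × ℂ => ((‖ξ.1‖ ^ (γ - 2) : ℝ) : ℂ)) _ ξ :=
    Complex.ofRealCLM.hasFDerivAt.comp ξ
      ((hasFDerivAt_norm_rpow_of_ne_zero (γ - 2) hξ).comp ξ (hasFDerivAt_fst (𝕜 := ℝ) (p := ξ)))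
  have h2 : HasFDerivAt (fun ξ : ℂ × ℂ => conj ξ.1) _ ξ :=
    Complex.conjCLE.toContinuousLinearMap.hasFDerivAt.comp ξ (hasFDerivAt_fst (𝕜 := ℝ) (p := ξ))
  have h3 := ((((h1.const_mul (γ : ℂ)).mul h2).mul_const w.1).add_const
    (Complex.I * w.2)).mul_const ((2 : ℂ)⁻¹)
  have e : fderiv ℝ (fun ξ : ℂ × ℂ =>
      (γ * (‖ξ.1‖ ^ (γ - 2) : ℝ) * conj ξ.1 * w.1 + Complex.I * w.2) / 2) ξ = _ := h3.fderiv
  rw [delBar, e0, e]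
  have hn : ‖ξ.1‖ ^ (γ - 2) = ‖ξ.1‖ ^ (γ - 2 - 2) * ‖ξ.1‖ ^ 2 := by
    rw [← Real.rpow_natCast, ← Real.rpow_add (norm_pos_iff.2 hξ)]
    congr 1
    push_cast
    ring
  have hsq : (((‖ξ.1‖ : ℝ) : ℂ)) ^ 2 = ξ.1 * conj ξ.1 := by
    rw [Complex.mul_conj, Complex.normSq_eq_norm_sq]; push_cast; rfl
  have hin : (v.1.re : ℂ) * ξ.1.re + v.1.im * ξ.1.im
      + Complex.I * (-(v.1.im * ξ.1.re) + v.1.re * ξ.1.im) = ξ.1 * conj v.1 := by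
    apply Complex.ext <;> simp <;> ring
  rw [hn]
  simp
  linear_combination (w.1 * γ * conj ξ.1 * (γ - 2) * (‖ξ.1‖ ^ (γ - 2 - 2) : ℝ) / 4) * hin
    - (w.1 * γ * (‖ξ.1‖ ^ (γ - 2 - 2) : ℝ) * (‖ξ.1‖ : ℂ) ^ 2 * conj v.1 / 4) * Complex.I_sq
    - (w.1 * γ * (γ - 2) * (‖ξ.1‖ ^ (γ - 2 - 2) : ℝ) * conj v.1 / 4) * hsq

theorem delBarDel_rho (hγ : 1 < γ) {ξ : ℂ × ℂ} (hξ : ξ.1 ≠ 0) (v w : ℂ × ℂ) :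
    delBarDel (fun ξ => (rho γ ξ : ℂ)) ξ v w
      = γ ^ 2 / 4 * (‖ξ.1‖ ^ (γ - 2) : ℝ) * (w.1 * conj v.1 - v.1 * conj w.1) := by
  rw [delBarDel, delBar_del_rho hγ hξ, delBar_del_rho hγ hξ]
  ring

theorem hasFDerivAt_chart (γ : ℝ) {s α θ : ℝ} (hα : 0 < α) :
    ∃ L : ℝ × ℝ × ℝ →L[ℝ] ℂ × ℂ, HasFDerivAt (chart γ) L (s, α, θ) ∧
      L (1, 0, 0) = (0, 1) ∧
      L (0, 1, 0) = (Complex.exp (θ * Complex.I), (γ * α ^ (γ - 1) : ℝ) * Complex.I) ∧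
      L (0, 0, 1) = (Complex.I * α * Complex.exp (θ * Complex.I), 0) := by
  have hs : HasFDerivAt (fun p : ℝ × ℝ × ℝ => p.1) _ (s, α, θ) := hasFDerivAt_fst (𝕜 := ℝ)
  have h2 : HasFDerivAt (fun p : ℝ × ℝ × ℝ => p.2) _ (s, α, θ) := hasFDerivAt_snd (𝕜 := ℝ)
  have ha : HasFDerivAt (fun p : ℝ × ℝ × ℝ => p.2.1) _ (s, α, θ) :=
    (hasFDerivAt_fst (𝕜 := ℝ) (p := (α, θ))).comp (s, α, θ) h2
  have ht : HasFDerivAt (fun p : ℝ × ℝ × ℝ => p.2.2) _ (s, α, θ) :=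
    (hasFDerivAt_snd (𝕜 := ℝ) (p := (α, θ))).comp (s, α, θ) h2
  have hs' := Complex.ofRealCLM.hasFDerivAt.comp (s, α, θ) hs
  have ha' := Complex.ofRealCLM.hasFDerivAt.comp (s, α, θ) ha
  have ht' := Complex.ofRealCLM.hasFDerivAt.comp (s, α, θ) ht
  have hr := Complex.ofRealCLM.hasFDerivAt.comp (s, α, θ) (ha.rpow_const (p := γ) (Or.inl hα.ne'))
  have hF := (ha'.mul ((ht'.mul_const Complex.I).cexp)).prodMk (hs'.add (hr.mul_const Complex.I))
  -- Near `α > 0` the absolute value in `chart` disappears.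
  have heq : chart γ =ᶠ[𝓝 (s, α, θ)] fun p : ℝ × ℝ × ℝ =>
      ((p.2.1 : ℂ) * Complex.exp (p.2.2 * Complex.I), (p.1 : ℂ) + ((p.2.1 ^ γ : ℝ) : ℂ) * Complex.I) := by
    have : ∀ᶠ p : ℝ × ℝ × ℝ in 𝓝 (s, α, θ), 0 < p.2.1 :=
      ha.continuousAt.eventually (lt_mem_nhds hα)
    filter_upwards [this] with p hp
    rw [chart, abs_of_pos hp]
  refine ⟨_, hF.congr_of_eventuallyEq heq, ?_, ?_, ?_⟩
  · simp
  · simp [mul_comm Complex.I]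
  · simp
    ring

/-- The `s`-direction has no `z₁`-component, so only `∂ρ(∂_s) · ∂̄∂ρ(∂_α, ∂_θ) =
(i/2)(iγ²α^(γ-1)/2)` survives in the numerator. -/
theorem kernel_chart (hγ : 1 < γ) (z : ℂ × ℂ) {s α θ : ℝ} (hα : 0 < α) :
    kernel (rho γ) z (chart γ (s, α, θ))
      (fderiv ℝ (chart γ) (s, α, θ) (1, 0, 0)) (fderiv ℝ (chart γ) (s, α, θ) (0, 1, 0))
      (fderiv ℝ (chart γ) (s, α, θ) (0, 0, 1))
      = (α ^ (γ - 1) : ℝ) * density γ z (chart γ (s, α, θ)) := by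
  obtain ⟨L, hL, h1, h2, h3⟩ := hasFDerivAt_chart γ (s := s) (θ := θ) hα
  have hn : ‖(chart γ (s, α, θ)).1‖ = α := norm_fst_param γ s θ hα
  have hne : (chart γ (s, α, θ)).1 ≠ 0 := norm_pos_iff.1 (by rw [hn]; exact hα)
  have hexp : Complex.exp (θ * Complex.I) * conj (Complex.exp (θ * Complex.I)) = 1 := by
    rw [Complex.mul_conj, Complex.normSq_eq_norm_sq, Complex.norm_exp_ofReal_mul_I]; simp
  have hd : del (fun ξ => (rho γ ξ : ℂ)) (chart γ (s, α, θ)) (chart γ (s, α, θ) - z)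
      = denom γ z (chart γ (s, α, θ)) / 2 := by rw [del_rho hγ]; rfl
  rw [hL.fderiv, h1, h2, h3, kernel]
  simp only [hd]
  rw [delBarDel_rho hγ hne, delBarDel_rho hγ hne, delBarDel_rho hγ hne, del_rho hγ, hn, density]
  have hp : α ^ (γ - 1) = α ^ (γ - 2) * α := by
    rw [← Real.rpow_add_one hα.ne']; congr 1; ring
  rw [hp]
  simp only [map_mul, map_zero, Complex.conj_I, Complex.conj_ofReal]
  generalize hE : Complex.exp (θ * Complex.I) = E at hexp ⊢
  have hpi : (Real.pi : ℂ) ≠ 0 := by exact_mod_cast Real.pi_ne_zero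
  have hI := Complex.I_sq
  -- If the denominator vanishes, both sides are `0` by the convention for division.
  by_cases hD : denom γ z (chart γ (s, α, θ)) = 0
  · simp [hD]
  · push_cast
    field_simp
    linear_combination 2 * Complex.I ^ 2 * γ ^ 2 * (α ^ (γ - 2) : ℝ) * α * hexp

end Kernel

/-! ### Expansion of the Leray kernel -/

section Expansion

variable {γ : ℝ} {z : ℂ × ℂ}

open ComplexConjugate

/-- The coefficients of the expansion of the conjugate of the Leray kernel into waves. -/
def coeff (γ : ℝ) (z : ℂ × ℂ) (k : ℕ) (t : ℝ) : ℂ :=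
  (2 * Real.pi : ℂ)⁻¹ * gain γ k * profileConst γ k 1 * (t ^ profileExp γ k : ℝ) * conj z.1 ^ k *
    Complex.exp (-(Complex.I * t * conj z.2))

theorem im_pos_of_mem_Omega (hz : z ∈ Omega γ) : 0 < z.2.im :=
  lt_of_le_of_lt (Real.rpow_nonneg (norm_nonneg _) _) hz

theorem norm_coeff (hγ : 1 < γ) (k : ℕ) {t : ℝ} (ht : 0 < t) :
    ‖coeff γ z k t‖ = (2 * Real.pi)⁻¹ * gain γ k * profileConst γ k 1 * ‖z.1‖ ^ k
      * (t ^ profileExp γ k * Real.exp (-(t * z.2.im))) := by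
  have h1 := gain_pos hγ k
  have h2 := profileConst_pos (γ := γ) (m := k) (b := 1) (by linarith) (by positivity) one_pos
  have e1 : ‖(2 * Real.pi : ℂ)⁻¹‖ = (2 * Real.pi)⁻¹ := by
    rw [norm_inv, norm_mul, Complex.norm_real, Complex.norm_ofNat,
      Real.norm_of_nonneg Real.pi_pos.le]
  rw [coeff, norm_mul, norm_mul, norm_mul, norm_mul, norm_mul, e1, Complex.norm_real,
    Complex.norm_real, Complex.norm_real, Real.norm_of_nonneg h1.le, Real.norm_of_nonneg h2.le,
    Real.norm_of_nonneg (by positivity), norm_pow, RCLike.norm_conj, Complex.norm_exp]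
  have : (-(Complex.I * t * conj z.2)).re = -(t * z.2.im) := by simp
  rw [this]
  ring

theorem measurable_coeff (γ : ℝ) (z : ℂ × ℂ) (k : ℕ) : Measurable (coeff γ z k) := by
  unfold coeff
  fun_prop

theorem memLp_coeff (hγ : 1 < γ) (hz : z ∈ Omega γ) (k : ℕ) : MemLp (coeff γ z k) 2 halfLine := by
  have hp := profileExp_pos (γ := γ) (m := k) (by linarith) (by positivity)
  refine MemLp.of_le (((memLp_rpow_mul_exp hp (im_pos_of_mem_Omega hz)).const_mul
    ((2 * Real.pi)⁻¹ * gain γ k * profileConst γ k 1 * ‖z.1‖ ^ k)))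
    (measurable_coeff γ z k).aestronglyMeasurable ?_
  filter_upwards [ae_restrict_mem measurableSet_Ioi] with t ht
  rw [norm_coeff hγ k ht]
  exact le_abs_self _

/-- Displays a geometric series with a linear factor; its ratio `|z₁|²/(Im z₂)^(2/γ)` is less than
`1` on `Ω_γ`. -/
theorem integral_norm_sq_coeff (hγ : 1 < γ) (hz : z ∈ Omega γ) (k : ℕ) :
    ∫ t in Ioi 0, ‖coeff γ z k t‖ ^ 2 = gain γ k ^ 2 * (γ / (4 * Real.pi ^ 2 * z.2.im ^ 2)
      * ((k / γ + 1 / 2) * (‖z.1‖ ^ 2 / z.2.im ^ (2 / γ)) ^ k)) := by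
  have hγ0 : 0 < γ := by linarith
  have hy := im_pos_of_mem_Omega hz
  have hp := profileExp_pos (γ := γ) (m := k) hγ0 (by positivity)
  have e : ∀ t ∈ Ioi (0 : ℝ), ‖coeff γ z k t‖ ^ 2
      = ((2 * Real.pi)⁻¹ * gain γ k * profileConst γ k 1 * ‖z.1‖ ^ k) ^ 2
        * (t ^ (2 * profileExp γ k + 1 - 1) * Real.exp (-(2 * z.2.im * t))) := by
    intro t ht
    have ht : 0 < t := ht
    rw [norm_coeff hγ k ht, mul_pow _ (_ * _), mul_pow (t ^ _), ← Real.rpow_mul_natCast ht.le,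
      sq (Real.exp _), ← Real.exp_add, add_sub_cancel_right]
    congr 3
    · push_cast; ring
    · ring
  rw [setIntegral_congr_fun measurableSet_Ioi e, integral_const_mul,
    Real.integral_rpow_mul_exp_neg_mul_Ioi (by positivity) (by positivity)]
  have hG := Real.Gamma_pos_of_pos (s := 2 * profileExp γ k) (by positivity)
  have hpe : 2 * profileExp γ k + 1 = 2 / γ * k + 2 := by unfold profileExp; field_simp; ring
  rw [mul_pow, mul_pow, mul_pow, sq_profileConst hγ0 (by positivity) one_pos,
    Real.Gamma_add_one (by positivity), one_div, Real.inv_rpow (by positivity),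
    Real.mul_rpow (by positivity) hy.le, Real.rpow_add_one (by norm_num : (2 : ℝ) ≠ 0), mul_one, hpe,
    Real.rpow_add hy, Real.rpow_mul hy.le, Real.rpow_natCast, Real.rpow_two, div_pow]
  have h3 : (2 : ℝ) ^ (2 * profileExp γ k) ≠ 0 := (Real.rpow_pos_of_pos (by norm_num) _).ne'
  have h4 : z.2.im ^ (2 / γ) ≠ 0 := (Real.rpow_pos_of_pos hy _).ne'
  have h5 : profileExp γ k = k / γ + 1 / 2 := by unfold profileExp; field_simp
  rw [h5] at h3 hG ⊢
  field_simp
  ring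

theorem summable_integral_norm_sq_coeff (hγ : 1 < γ) (hz : z ∈ Omega γ) :
    Summable fun k => ∫ t in Ioi 0, ‖coeff γ z k t‖ ^ 2 := by
  have hγ0 : 0 < γ := by linarith
  have hy := im_pos_of_mem_Omega hz
  have hr : ‖‖z.1‖ ^ 2 / z.2.im ^ (2 / γ)‖ < 1 := by
    rw [Real.norm_of_nonneg (by positivity), div_lt_one (by positivity)]
    have h1 : (‖z.1‖ ^ γ) ^ (2 / γ) < z.2.im ^ (2 / γ) :=
      Real.rpow_lt_rpow (by positivity) hz (by positivity)
    rwa [← Real.rpow_mul (norm_nonneg _), mul_div_cancel₀ _ hγ0.ne', Real.rpow_two] at h1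
  have h1 := summable_pow_mul_geometric_of_norm_lt_one 1 hr
  have h0 := summable_geometric_of_norm_lt_one hr
  have h2 : Summable fun k : ℕ => gain γ 0 ^ 2 * (γ / (4 * Real.pi ^ 2 * z.2.im ^ 2)
      * ((k / γ + 1 / 2) * (‖z.1‖ ^ 2 / z.2.im ^ (2 / γ)) ^ k)) := by
    refine Summable.mul_left _ (Summable.mul_left _ ?_)
    refine ((h1.mul_left γ⁻¹).add (h0.mul_left (1 / 2))).congr fun k => ?_
    rw [pow_one]
    ring
  refine Summable.of_nonneg_of_le (fun k => integral_nonneg fun t => by positivity)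
    (fun k => ?_) h2
  rw [integral_norm_sq_coeff hγ hz]
  have := (gain_pos hγ k).le
  gcongr
  exact gain_le hγ k

/-- Young's inequality with exponents `γ` and `γ/(γ-1)`. This is `|X| < Re Y`: the expansion
converges and the denominator has no zero on `Ω_γ`. -/
theorem rpow_mul_le_of_mem_Omega (hγ : 1 < γ) (hz : z ∈ Omega γ) {α : ℝ} (hα : 0 < α) :
    γ * α ^ (γ - 1) * ‖z.1‖ < (γ - 1) * α ^ γ + z.2.im := by
  have hγ0 : 0 < γ := by linarith
  have h1 : 0 < γ - 1 := by linarith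
  have h := Real.young_inequality_of_nonneg (norm_nonneg z.1)
    (Real.rpow_nonneg hα.le (γ - 1)) (Real.HolderConjugate.conjExponent hγ)
  rw [Real.conjExponent, ← Real.rpow_mul hα.le, mul_div_cancel₀ _ h1.ne'] at h
  have h2 := mul_le_mul_of_nonneg_left h hγ0.le
  have h3 : γ * (‖z.1‖ ^ γ / γ + α ^ γ / (γ / (γ - 1))) = ‖z.1‖ ^ γ + (γ - 1) * α ^ γ := by
    field_simp
  have hz : ‖z.1‖ ^ γ < z.2.im := hz
  nlinarith

/-! ### Laplace integrals of powers. -/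

theorem norm_pow_mul_exp (Y : ℂ) (n : ℕ) {t : ℝ} (ht : 0 < t) :
    ‖(t : ℂ) ^ n * Complex.exp (-(Y * t))‖ = t ^ (n : ℝ) * Real.exp (-Y.re * t) := by
  rw [norm_mul, norm_pow, Complex.norm_real, Real.norm_of_nonneg ht.le, Complex.norm_exp,
    Real.rpow_natCast]
  simp

theorem integrableOn_pow_mul_exp {Y : ℂ} (hY : 0 < Y.re) (n : ℕ) :
    IntegrableOn (fun t : ℝ => (t : ℂ) ^ n * Complex.exp (-(Y * t))) (Ioi 0) := by
  have h := integrableOn_rpow_mul_exp_neg_mul_rpow (p := 1) (s := n) (b := Y.re)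
    (neg_one_lt_zero.trans_le (Nat.cast_nonneg n)) one_pos hY
  refine Integrable.mono' h (by fun_prop) ?_
  filter_upwards [ae_restrict_mem measurableSet_Ioi] with t ht
  rw [norm_pow_mul_exp Y n ht, Real.rpow_one]

/-- Integration by parts, one power of `t` at a time. -/
theorem integral_pow_mul_exp {Y : ℂ} (hY : 0 < Y.re) (n : ℕ) :
    ∫ t : ℝ in Ioi 0, (t : ℂ) ^ n * Complex.exp (-(Y * t)) = n.factorial / Y ^ (n + 1) := by
  have hY0 : Y ≠ 0 := fun h => by simp [h] at hY
  induction n with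
  | zero =>
    have h := integral_exp_mul_complex_Ioi (a := -Y) (by simpa using hY) 0
    simp only [neg_mul] at h
    simp [h]
  | succ n ih =>
    have hd : ∀ t ∈ Ici (0 : ℝ), HasDerivAt
        (fun t : ℝ => -((t : ℂ) ^ (n + 1) * Complex.exp (-(Y * t))) / Y)
        ((t : ℂ) ^ (n + 1) * Complex.exp (-(Y * t))
          - (n + 1) / Y * ((t : ℂ) ^ n * Complex.exp (-(Y * t)))) t := fun t _ => by
      have h1 := (hasDerivAt_id (t : ℂ)).pow (n + 1)
      have h2 := (((hasDerivAt_id (t : ℂ)).const_mul Y).neg).cexp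
      have h3 : HasDerivAt (fun t : ℝ => -((t : ℂ) ^ (n + 1) * Complex.exp (-(Y * t))) / Y) _ t :=
        ((h1.mul h2).neg.div_const Y).comp_ofReal
      refine h3.congr_deriv ?_
      simp
      field_simp
      ring
    have hlim : Tendsto (fun t : ℝ => -((t : ℂ) ^ (n + 1) * Complex.exp (-(Y * t))) / Y) atTop
        (𝓝 0) := by
      have h := tendsto_rpow_mul_exp_neg_mul_atTop_nhds_zero ((n + 1 : ℕ) : ℝ) Y.re hY
      have h2 : Tendsto (fun t : ℝ => (t : ℂ) ^ (n + 1) * Complex.exp (-(Y * t))) atTop (𝓝 0) := by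
        rw [tendsto_zero_iff_norm_tendsto_zero]
        refine h.congr' ?_
        filter_upwards [eventually_gt_atTop 0] with t ht
        rw [norm_pow_mul_exp Y _ ht]
      simpa using h2.neg.div_const Y
    have hi := integrableOn_pow_mul_exp hY n
    have hi' := integrableOn_pow_mul_exp hY (n + 1)
    have h := integral_Ioi_of_hasDerivAt_of_tendsto' hd (hi'.sub (hi.const_mul ((n + 1) / Y))) hlim
    rw [integral_sub hi' (hi.const_mul _), integral_const_mul, ih] at h
    rw [sub_eq_iff_eq_add.1 h, Nat.factorial_succ]
    push_cast
    field_simp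
    simp
    ring

/-! ### Summation of the expansion. -/

theorem wave_coeff (hγ : 1 < γ) (hz : z ∈ Omega γ) {ζ : M γ} (hζ : 0 < ‖(ζ : ℂ × ℂ).1‖) (k : ℕ) :
    wave k (profileMul γ ((γ - 1) * k) (γ - 1) (coeff γ z k)) ζ
      = γ ^ 2 / (4 * Real.pi ^ 2) * ((k + 1) *
        (γ * (‖(ζ : ℂ × ℂ).1‖ ^ (γ - 1) : ℝ) * ((ζ : ℂ × ℂ).1 / ‖(ζ : ℂ × ℂ).1‖) * conj z.1) ^ k /
        ((γ - 1) * (‖(ζ : ℂ × ℂ).1‖ ^ γ : ℝ) - Complex.I * (ζ : ℂ × ℂ).2.re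
          + Complex.I * conj z.2) ^ (k + 2)) := by
  have hγ0 : 0 < γ := by linarith
  have hy := im_pos_of_mem_Omega hz
  set α := ‖(ζ : ℂ × ℂ).1‖ with hα
  set ω := (ζ : ℂ × ℂ).1 / α
  set s := (ζ : ℂ × ℂ).2.re
  set Y : ℂ := (γ - 1) * (α ^ γ : ℝ) - Complex.I * s + Complex.I * conj z.2 with hYdef
  have hY : 0 < Y.re := by
    have h1 : 0 < γ - 1 := by linarith
    have : Y.re = (γ - 1) * α ^ γ + z.2.im := by simp [hYdef]
    rw [this]
    positivity
  have e : ∀ t ∈ Ioi (0 : ℝ), Complex.exp (t * s * Complex.I)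
      * profileMul γ ((γ - 1) * k) (γ - 1) (coeff γ z k) t α
      = (2 * Real.pi : ℂ)⁻¹ * (γ ^ (k + 2) / k.factorial) * conj z.1 ^ k * ((α ^ (γ - 1) : ℝ) : ℂ) ^ k
        * ((t : ℂ) ^ (k + 1) * Complex.exp (-(Y * t))) := by
    intro t ht
    have ht : 0 < t := ht
    have h1 : α ^ ((γ - 1) * k) = (α ^ (γ - 1)) ^ k := by
      rw [Real.rpow_mul hζ.le, Real.rpow_natCast]
    have h2 : t ^ (k + 1) = t ^ profileExp γ k * t ^ profileExp γ ((γ - 1) * k) := by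
      rw [← Real.rpow_add ht, add_comm (profileExp γ k), profileExp_add hγ0, ← Real.rpow_natCast]
      push_cast
      rfl
    have h3 : Complex.exp (-(Y * t)) = Complex.exp (t * s * Complex.I)
        * Complex.exp (-(Complex.I * t * conj z.2)) * Complex.exp (-(t * (γ - 1) * (α ^ γ : ℝ))) := by
      rw [← Complex.exp_add, ← Complex.exp_add, hYdef]
      congr 1
      ring
    have h4 : (γ ^ (k + 2) / k.factorial : ℂ) = (gain γ k * profileConst γ k 1
        * profileConst γ ((γ - 1) * k) (γ - 1) : ℝ) := by
      rw [gain_mul_const hγ]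
      push_cast
      rfl
    rw [profileMul, profile, coeff, h1, h3, h4, ← Complex.ofReal_pow t, h2]
    push_cast
    ring
  rw [wave, fourierHalf, setIntegral_congr_fun measurableSet_Ioi e, integral_const_mul,
    integral_pow_mul_exp hY, Nat.factorial_succ]
  have hpi : (Real.pi : ℂ) ≠ 0 := by exact_mod_cast Real.pi_ne_zero
  have hY0 : Y ≠ 0 := fun h => by simp [h] at hY
  have hk : (k.factorial : ℂ) ≠ 0 := by exact_mod_cast k.factorial_ne_zero
  push_cast
  rw [mul_pow, mul_pow, mul_pow]
  field_simp
  ring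

/-- On `M_γ` the first term gives `γ|ζ₁|^γ` and `Im ζ₂ = |ζ₁|^γ` removes one copy, leaving the
factor `γ - 1`. -/
theorem conj_denom {ζ : M γ} (hζ : 0 < ‖(ζ : ℂ × ℂ).1‖) :
    conj (denom γ z ζ) = ((γ - 1) * (‖(ζ : ℂ × ℂ).1‖ ^ γ : ℝ) - Complex.I * (ζ : ℂ × ℂ).2.re
          + Complex.I * conj z.2)
      - γ * (‖(ζ : ℂ × ℂ).1‖ ^ (γ - 1) : ℝ) * ((ζ : ℂ × ℂ).1 / ‖(ζ : ℂ × ℂ).1‖) * conj z.1 := by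
  have him : (ζ : ℂ × ℂ).2.im = ‖(ζ : ℂ × ℂ).1‖ ^ γ := ζ.2
  have h2 : conj (ζ : ℂ × ℂ).2 = (ζ : ℂ × ℂ).2.re - Complex.I * (‖(ζ : ℂ × ℂ).1‖ ^ γ : ℝ) := by
    rw [← him]
    apply Complex.ext <;> simp
  have hsq : (ζ : ℂ × ℂ).1 * conj (ζ : ℂ × ℂ).1 = ((‖(ζ : ℂ × ℂ).1‖ : ℝ) : ℂ) ^ 2 := by
    rw [Complex.mul_conj, Complex.normSq_eq_norm_sq]; push_cast; rfl
  have e1 : ‖(ζ : ℂ × ℂ).1‖ ^ γ = ‖(ζ : ℂ × ℂ).1‖ ^ (γ - 2) * ‖(ζ : ℂ × ℂ).1‖ ^ 2 := by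
    rw [← Real.rpow_natCast, ← Real.rpow_add hζ]; congr 1; push_cast; ring
  have e2 : ‖(ζ : ℂ × ℂ).1‖ ^ (γ - 1) = ‖(ζ : ℂ × ℂ).1‖ ^ (γ - 2) * ‖(ζ : ℂ × ℂ).1‖ := by
    rw [← Real.rpow_add_one hζ.ne']; congr 1; ring
  have hne : ((‖(ζ : ℂ × ℂ).1‖ : ℝ) : ℂ) ≠ 0 := by exact_mod_cast hζ.ne'
  rw [denom]
  simp only [map_add, map_sub, map_mul, Complex.conj_ofReal, Complex.conj_conj, Complex.conj_I]
  rw [h2, e2, e1]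
  push_cast
  field_simp
  linear_combination γ * (‖(ζ : ℂ × ℂ).1‖ ^ (γ - 2) : ℝ) * hsq
    + (‖(ζ : ℂ × ℂ).1‖ ^ (γ - 2) : ℝ) * (‖(ζ : ℂ × ℂ).1‖ : ℂ) ^ 2 * Complex.I_sq

/-- `∑ (k+1) w^k = (1-w)⁻²` at `w = X/Y`. The conjugate appears because the kernel enters the
conjugate-linear slot of the inner product. -/
theorem hasSum_wave_coeff (hγ : 1 < γ) (hz : z ∈ Omega γ) {ζ : M γ}
    (hζ : 0 < ‖(ζ : ℂ × ℂ).1‖) :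
    HasSum (fun k => wave k (profileMul γ ((γ - 1) * k) (γ - 1) (coeff γ z k)) ζ)
      (conj (density γ z ζ)) := by
  have hγ0 : 0 < γ := by linarith
  have h1 : 0 < γ - 1 := by linarith
  have hy := im_pos_of_mem_Omega hz
  have hd := conj_denom (z := z) hζ
  simp only [wave_coeff hγ hz hζ]
  have hX : ‖(γ * (‖(ζ : ℂ × ℂ).1‖ ^ (γ - 1) : ℝ) * ((ζ : ℂ × ℂ).1 / ‖(ζ : ℂ × ℂ).1‖)
      * conj z.1 : ℂ)‖ = γ * ‖(ζ : ℂ × ℂ).1‖ ^ (γ - 1) * ‖z.1‖ := by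
    rw [norm_mul, norm_mul, norm_mul, norm_div, Complex.norm_real, Complex.norm_real,
      Complex.norm_real, Real.norm_of_nonneg hγ0.le, Real.norm_of_nonneg (by positivity),
      norm_norm, div_self hζ.ne', mul_one, RCLike.norm_conj]
  have hYre : (((γ - 1) * (‖(ζ : ℂ × ℂ).1‖ ^ γ : ℝ) - Complex.I * (ζ : ℂ × ℂ).2.re
          + Complex.I * conj z.2) : ℂ).re = (γ - 1) * ‖(ζ : ℂ × ℂ).1‖ ^ γ + z.2.im := by simp
  have hXY := rpow_mul_le_of_mem_Omega hγ hz hζ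
  rw [← hX, ← hYre] at hXY
  rw [density, map_div₀, map_pow, hd]
  generalize (γ * (‖(ζ : ℂ × ℂ).1‖ ^ (γ - 1) : ℝ) * ((ζ : ℂ × ℂ).1 / ‖(ζ : ℂ × ℂ).1‖)
      * conj z.1 : ℂ) = X at hXY ⊢
  generalize ((γ - 1) * (‖(ζ : ℂ × ℂ).1‖ ^ γ : ℝ) - Complex.I * (ζ : ℂ × ℂ).2.re
          + Complex.I * conj z.2 : ℂ) = Y at hXY ⊢
  have hYn : ‖X‖ < ‖Y‖ := hXY.trans_le (Complex.re_le_norm Y)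
  have hY0 : Y ≠ 0 := norm_pos_iff.1 ((norm_nonneg X).trans_lt hYn)
  have hlt : ‖X / Y‖ < 1 := by rwa [norm_div, div_lt_one (norm_pos_iff.2 hY0)]
  have hne : Y - X ≠ 0 := fun h => by rw [sub_eq_zero.1 h] at hYn; exact lt_irrefl _ hYn
  have hs := (hasSum_choose_mul_geometric_of_norm_lt_one 1 hlt).mul_left
    (γ ^ 2 / (4 * Real.pi ^ 2) / Y ^ 2 : ℂ)
  have e : conj (γ ^ 2 / (4 * Real.pi ^ 2) : ℂ) / (Y - X) ^ 2
      = γ ^ 2 / (4 * Real.pi ^ 2) / Y ^ 2 * (1 / (1 - X / Y) ^ (1 + 1)) := by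
    rw [map_div₀, map_mul, map_pow, map_pow, Complex.conj_ofReal, Complex.conj_ofReal, map_ofNat,
      one_sub_div hY0, div_pow]
    field_simp
    ring
  rw [e]
  refine Eq.subst (motive := fun F : ℕ → ℂ => HasSum F _) (funext fun k => ?_) hs
  rw [Nat.choose_one_right, div_pow]
  push_cast
  field_simp
  ring

end Expansion

/-! ### The Leray integral as an inner product -/

section Transform

variable {γ : ℝ}

open ComplexConjugate

theorem integrand_eq (hγ : 1 < γ) (f : M γ → ℂ) (z : ℂ × ℂ) {p : ℝ × ℝ × ℝ} (hp : p ∈ params) :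
    integrand γ f z p = (ENNReal.ofReal (p.2.1 ^ (γ - 1))).toReal •
      (f (param γ p) * density γ z (param γ p)) := by
  obtain ⟨s, α, θ⟩ := p
  have hα : 0 < α := hp.2.1
  rw [integrand, kernel_chart hγ z hα, ENNReal.toReal_ofReal (Real.rpow_nonneg hα.le _),
    Complex.real_smul]
  simp only [param]
  ring

theorem measurableSet_params : MeasurableSet params :=
  MeasurableSet.univ.prod (measurableSet_Ioi.prod measurableSet_Ico)

theorem integrableOn_integrand (hγ : 1 < γ) {f : M γ → ℂ} {z : ℂ × ℂ}
    (h : Integrable (fun ζ : M γ => f ζ * density γ z ζ) (sigma γ)) :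
    IntegrableOn (integrand γ f z) params := by
  have h1 := h.comp_measurable (measurable_param (by linarith))
  rw [integrable_withDensity_iff_integrable_smul' (by fun_prop)
    (Eventually.of_forall fun _ => ENNReal.ofReal_lt_top)] at h1
  exact IntegrableOn.congr_fun h1 (fun p hp => (integrand_eq hγ f z hp).symm) measurableSet_params

theorem transform_eq (hγ : 1 < γ) {f : M γ → ℂ} {z : ℂ × ℂ}
    (h : Integrable (fun ζ : M γ => f ζ * density γ z ζ) (sigma γ)) :
    transform γ f z = ∫ ζ, f ζ * density γ z ζ ∂sigma γ := by
  have hm := h.aestronglyMeasurable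
  rw [sigma] at hm ⊢
  rw [integral_map (measurable_param (by linarith)).aemeasurable hm,
    integral_withDensity_eq_integral_toReal_smul (by fun_prop)
      (Eventually.of_forall fun _ => ENNReal.ofReal_lt_top), transform]
  exact setIntegral_congr_fun measurableSet_params fun p hp => integrand_eq hγ f z hp

/-! ### The isometries onto the Fourier components -/

/-- The isometry onto the orthogonal complement of the kernel of the `k`-th component. -/
def inWave (hγ : 1 < γ) (k : ℕ) : HalfL2 →ₗᵢ[ℂ] Lp ℂ 2 (sigma γ) :=
  waveLp (m := (γ - 1) * k) (b := γ - 1) (zero_lt_one.trans hγ)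
    (mul_nonneg (sub_nonneg.2 hγ.le) k.cast_nonneg) (sub_pos.2 hγ) k

/-- The isometry onto the range of the `k`-th component. -/
def outWave (hγ : 1 < γ) (k : ℕ) : HalfL2 →ₗᵢ[ℂ] Lp ℂ 2 (sigma γ) :=
  waveLp (m := k) (b := 1) (zero_lt_one.trans hγ) k.cast_nonneg one_pos k

theorem orthogonalFamily_inWave (hγ : 1 < γ) :
    OrthogonalFamily ℂ (fun _ : ℕ => HalfL2) (inWave hγ) := fun k l hkl φ ψ => by
  rw [inWave, inWave, inner_waveLp_waveLp, if_neg hkl]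

theorem orthogonalFamily_outWave (hγ : 1 < γ) :
    OrthogonalFamily ℂ (fun _ : ℕ => HalfL2) (outWave hγ) := fun k l hkl φ ψ => by
  rw [outWave, outWave, inner_waveLp_waveLp, if_neg hkl]

theorem inner_inWave_outWave (hγ : 1 < γ) (k l : ℕ) (φ ψ : HalfL2) :
    inner ℂ (inWave hγ k φ) (outWave hγ l ψ)
      = if k = l then ((gain γ k)⁻¹ : ℝ) * inner ℂ φ ψ else 0 := by
  rw [inWave, outWave, inner_waveLp_waveLp]
  split_ifs with h
  · rw [← h, gain, inv_inv]
  · rfl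

/-- `ℓ²(ℕ, L²(0, ∞))`. -/
abbrev Spectral : Type := lp (fun _ : ℕ => HalfL2) 2

def inSynthesis (hγ : 1 < γ) : Spectral →L[ℂ] Lp ℂ 2 (sigma γ) :=
  (orthogonalFamily_inWave hγ).linearIsometry.toContinuousLinearMap

def outSynthesis (hγ : 1 < γ) : Spectral →L[ℂ] Lp ℂ 2 (sigma γ) :=
  (orthogonalFamily_outWave hγ).linearIsometry.toContinuousLinearMap

/-- The spectral coefficients of `f`. -/
def analysis (hγ : 1 < γ) : Lp ℂ 2 (sigma γ) →L[ℂ] Spectral :=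
  ContinuousLinearMap.adjoint (inSynthesis hγ)

theorem hasSum_inSynthesis (hγ : 1 < γ) (g : Spectral) :
    HasSum (fun k => inWave hγ k (g k)) (inSynthesis hγ g) :=
  (orthogonalFamily_inWave hγ).hasSum_linearIsometry g

theorem hasSum_outSynthesis (hγ : 1 < γ) (g : Spectral) :
    HasSum (fun k => outWave hγ k (g k)) (outSynthesis hγ g) :=
  (orthogonalFamily_outWave hγ).hasSum_linearIsometry g

theorem norm_outSynthesis (hγ : 1 < γ) (g : Spectral) : ‖outSynthesis hγ g‖ = ‖g‖ :=
  (orthogonalFamily_outWave hγ).linearIsometry.norm_map g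

theorem norm_analysis_le (hγ : 1 < γ) : ‖analysis hγ‖ ≤ 1 := by
  rw [analysis, LinearIsometryEquiv.norm_map]
  exact LinearIsometry.norm_toContinuousLinearMap_le _

theorem analysis_apply (hγ : 1 < γ) (f : Lp ℂ 2 (sigma γ)) (k : ℕ) :
    analysis hγ f k = ContinuousLinearMap.adjoint (inWave hγ k).toContinuousLinearMap f :=
  adjoint_linearIsometry_apply (orthogonalFamily_inWave hγ) f k

/-- The source of `L² = L`: analyzing the output divides by the gain that the diagonal operator
multiplies by. -/
theorem analysis_outSynthesis (hγ : 1 < γ) (g : Spectral) (k : ℕ) :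
    analysis hγ (outSynthesis hγ g) k = ((gain γ k)⁻¹ : ℂ) • g k := by
  refine ext_inner_left ℂ fun φ => ?_
  rw [analysis_apply, ContinuousLinearMap.adjoint_inner_right]
  have h := (hasSum_outSynthesis hγ g).mapL (innerSL ℂ (inWave hγ k φ))
  simp only [innerSL_apply_apply, inner_inWave_outWave] at h
  have h2 := h.unique (hasSum_single k fun l hl => if_neg (Ne.symm hl))
  rw [if_pos rfl] at h2
  rw [inner_smul_right]
  exact_mod_cast h2

/-! ### Damping -/

/-- The absolute value keeps the multiplier bounded for every real `ε`, so that `damp` is total;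
only `ε > 0` matters. -/
theorem memLp_damp (ε : ℝ) (φ : HalfL2) :
    MemLp (fun t : ℝ => Complex.exp (-(|ε| * t : ℝ)) * φ t) 2 halfLine := by
  refine MemLp.of_le (Lp.memLp φ) (AEStronglyMeasurable.mul (by fun_prop)
    (Lp.aestronglyMeasurable φ)) ?_
  filter_upwards [ae_restrict_mem measurableSet_Ioi] with t ht
  have ht : 0 < t := ht
  rw [norm_mul, Complex.norm_exp]
  refine mul_le_of_le_one_left (norm_nonneg _) (Real.exp_le_one_iff.2 ?_)
  rw [← Complex.ofReal_neg, Complex.ofReal_re]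
  exact neg_nonpos.2 (by positivity)

/-- Multiplication by `e^{-|ε|t}` on `L²(0, ∞)`. -/
def damp (ε : ℝ) : HalfL2 →L[ℂ] HalfL2 :=
  LinearMap.mkContinuous
    { toFun := fun φ => (memLp_damp ε φ).toLp _
      map_add' := fun φ ψ => by
        rw [← MemLp.toLp_add, MemLp.toLp_eq_toLp_iff]
        filter_upwards [Lp.coeFn_add φ ψ] with t ht
        rw [ht, Pi.add_apply, Pi.add_apply, mul_add]
      map_smul' := fun c φ => by
        rw [RingHom.id_apply, ← MemLp.toLp_const_smul, MemLp.toLp_eq_toLp_iff]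
        filter_upwards [Lp.coeFn_smul c φ] with t ht
        rw [ht, Pi.smul_apply, Pi.smul_apply, smul_eq_mul, smul_eq_mul, mul_left_comm] }
    1 fun φ => by
      rw [one_mul]
      refine Lp.norm_le_norm_of_ae_le ?_
      filter_upwards [(memLp_damp ε φ).coeFn_toLp, ae_restrict_mem measurableSet_Ioi] with t h ht
      have ht : 0 < t := ht
      refine (congrArg norm h).trans_le ?_
      rw [norm_mul, Complex.norm_exp]
      refine mul_le_of_le_one_left (norm_nonneg _) (Real.exp_le_one_iff.2 ?_)
      rw [← Complex.ofReal_neg, Complex.ofReal_re]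
      exact neg_nonpos.2 (by positivity)

theorem norm_damp_le (ε : ℝ) : ‖damp ε‖ ≤ 1 := LinearMap.mkContinuous_norm_le _ zero_le_one _

theorem coeFn_damp (ε : ℝ) (φ : HalfL2) :
    damp ε φ =ᵐ[halfLine] fun t : ℝ => Complex.exp (-(|ε| * t : ℝ)) * φ t :=
  (memLp_damp ε φ).coeFn_toLp

theorem tendsto_damp (φ : HalfL2) : Tendsto (fun ε => damp ε φ) (𝓝[>] 0) (𝓝 φ) := by
  rw [Lp.tendsto_Lp_iff_tendsto_eLpNorm']
  have e : ∀ ε, eLpNorm (damp ε φ - φ : ℝ → ℂ) 2 halfLine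
      = (∫⁻ t, ‖(Complex.exp (-(|ε| * t : ℝ)) - 1) * φ t‖ₑ ^ 2 ∂halfLine) ^ (1 / 2 : ℝ) := fun ε => by
    rw [eLpNorm_eq_lintegral_rpow_enorm_toReal (by norm_num) (by norm_num)]
    simp only [ENNReal.toReal_ofNat, ENNReal.rpow_two]
    congr 1
    refine lintegral_congr_ae ?_
    filter_upwards [coeFn_damp ε φ] with t ht
    rw [Pi.sub_apply, ht, sub_mul, one_mul]
  simp only [e]
  have h0 : Tendsto (fun ε : ℝ => ∫⁻ t, ‖(Complex.exp (-(|ε| * t : ℝ)) - 1) * φ t‖ₑ ^ 2 ∂halfLine)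
      (𝓝[>] 0) (𝓝 (∫⁻ _, 0 ∂halfLine)) := by
    refine tendsto_lintegral_filter_of_dominated_convergence (fun t => (2 * ‖φ t‖ₑ) ^ 2) ?_ ?_ ?_ ?_
    · refine Eventually.of_forall fun ε => ?_
      have := measurable_coe_halfL2 φ
      fun_prop
    · refine Eventually.of_forall fun ε => ?_
      filter_upwards [ae_restrict_mem measurableSet_Ioi] with t ht
      have ht : 0 < t := ht
      rw [enorm_mul]
      gcongr
      have h1 : ‖Complex.exp (-(|ε| * t : ℝ)) - 1‖ ≤ 2 := by
        refine (norm_sub_le _ _).trans ?_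
        rw [norm_one, Complex.norm_exp, ← Complex.ofReal_neg, Complex.ofReal_re]
        have : Real.exp (-(|ε| * t)) ≤ 1 := Real.exp_le_one_iff.2 (neg_nonpos.2 (by positivity))
        linarith
      rw [← ofReal_norm]
      exact (ENNReal.ofReal_le_ofReal h1).trans_eq (by simp)
    · simp only [mul_pow]
      rw [lintegral_const_mul' _ _ (by simp)]
      exact ENNReal.mul_ne_top (by simp) (lintegral_lt_top_of_memLp_two (Lp.memLp φ)).ne
    · refine Eventually.of_forall fun t => ?_
      have h1 : Continuous fun ε : ℝ => ‖(Complex.exp (-(|ε| * t : ℝ)) - 1) * φ t‖ₑ ^ 2 := by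
        fun_prop
      have h2 := (h1.tendsto 0).mono_left (nhdsWithin_le_nhds (s := Ioi 0))
      simpa using h2
  have h1 := h0.ennrpow_const (1 / 2)
  simpa using h1

end Transform

/-! ### The Leray transform -/

section Operator

variable {γ : ℝ} {z : ℂ × ℂ}

open ComplexConjugate

theorem norm_sq_toLp {X : Type*} [MeasurableSpace X] {μ : Measure X} {F : X → ℂ}
    (hF : MemLp F 2 μ) : ‖hF.toLp F‖ ^ 2 = ∫ x, ‖F x‖ ^ 2 ∂μ := by
  rw [Lp.norm_toLp, eLpNorm_eq_lintegral_rpow_enorm_toReal (by norm_num) (by norm_num)]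
  simp only [ENNReal.toReal_ofNat, ENNReal.rpow_two]
  rw [lintegral_enorm_sq_eq_ofReal hF, ← ENNReal.toReal_rpow,
    ENNReal.toReal_ofReal (integral_nonneg fun x => by positivity), ← Real.sqrt_eq_rpow,
    Real.sq_sqrt (integral_nonneg fun x => by positivity)]

/-- The spectral coefficients of the conjugate of the Leray kernel. -/
def coeffSeq (hγ : 1 < γ) (hz : z ∈ Omega γ) : Spectral :=
  ⟨fun k => (memLp_coeff hγ hz k).toLp _, by
    refine (memℓp_gen_iff (by norm_num)).2 ?_
    simp only [ENNReal.toReal_ofNat, Real.rpow_two, norm_sq_toLp]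
    exact summable_integral_norm_sq_coeff hγ hz⟩

theorem coeFn_coeffSeq (hγ : 1 < γ) (hz : z ∈ Omega γ) (k : ℕ) :
    (coeffSeq hγ hz k : HalfL2) =ᵐ[halfLine] coeff γ z k :=
  (memLp_coeff hγ hz k).coeFn_toLp

theorem inSynthesis_coeffSeq (hγ : 1 < γ) (hz : z ∈ Omega γ) :
    inSynthesis hγ (coeffSeq hγ hz) =ᵐ[sigma γ] fun ζ => conj (density γ z ζ) := by
  refine ae_eq_of_hasSum (hasSum_inSynthesis hγ _) (fun k => coeFn_waveLp _ _ _ k _) ?_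
  filter_upwards [ae_fst_ne_zero (zero_lt_one.trans hγ)] with ζ hζ
  simp only [wave_congr_ae (coeFn_coeffSeq hγ hz _)]
  exact hasSum_wave_coeff hγ hz hζ

theorem inner_inSynthesis_coeffSeq_ae (hγ : 1 < γ) (hz : z ∈ Omega γ) (f : Lp ℂ 2 (sigma γ)) :
    (fun ζ => inner ℂ (inSynthesis hγ (coeffSeq hγ hz) ζ) (f ζ))
      =ᵐ[sigma γ] fun ζ => f ζ * density γ z ζ := by
  filter_upwards [inSynthesis_coeffSeq hγ hz] with ζ hζ
  rw [hζ, RCLike.inner_apply, Complex.conj_conj]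

theorem integrable_mul_density (hγ : 1 < γ) (hz : z ∈ Omega γ) (f : Lp ℂ 2 (sigma γ)) :
    Integrable (fun ζ : M γ => f ζ * density γ z ζ) (sigma γ) :=
  (L2.integrable_inner _ f).congr (inner_inSynthesis_coeffSeq_ae hγ hz f)

/-- `Lf(z)` is the inner product of the conjugate kernel with `f`. That kernel is synthesized from
`coeffSeq`, so the adjoint moves the pairing to `ℓ²`; its membership in `L²` is also what makes the
integral absolutely convergent. -/
theorem hasSum_transform (hγ : 1 < γ) (hz : z ∈ Omega γ) (f : Lp ℂ 2 (sigma γ)) :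
    HasSum (fun k => ∫ t in Ioi 0, inner ℂ (coeff γ z k t) ((analysis hγ f k : HalfL2) t))
      (transform γ f z) := by
  have h := lp.hasSum_inner (𝕜 := ℂ) (coeffSeq hγ hz) (analysis hγ f)
  rw [analysis, ContinuousLinearMap.adjoint_inner_right, L2.inner_def,
    integral_congr_ae (inner_inSynthesis_coeffSeq_ae hγ hz f),
    ← transform_eq hγ (integrable_mul_density hγ hz f)] at h
  refine Eq.subst (motive := fun F : ℕ → ℂ => HasSum F _) (funext fun k => ?_) h
  rw [L2.inner_def]
  refine integral_congr_ae ?_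
  filter_upwards [coeFn_coeffSeq hγ hz k] with t ht
  rw [ht]
  rfl

theorem lift_mem_Omega {ε : ℝ} (hε : 0 < ε) (ζ : M γ) : lift ε ζ ∈ Omega γ := by
  have h : (ζ : ℂ × ℂ).2.im = ‖(ζ : ℂ × ℂ).1‖ ^ γ := ζ.2
  simp [Omega, lift, h, hε]

/-- At `(ζ₁, ζ₂ + iε)` the factor `e^(itz₂)` is `e^(its) e^(-t|ζ₁|^γ) e^(-εt)`: an oscillation, the
outgoing profile and the damping. -/
theorem integral_inner_coeff_lift {ε : ℝ} (hε : 0 < ε) {ζ : M γ}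
    (hζ : 0 < ‖(ζ : ℂ × ℂ).1‖) (k : ℕ) (φ : HalfL2) :
    ∫ t in Ioi 0, inner ℂ (coeff γ (lift ε ζ) k t) (φ t)
      = gain γ k * wave k (profileMul γ k 1 (damp ε φ)) ζ := by
  rw [wave_congr_ae (coeFn_damp ε φ), wave, fourierHalf, ← mul_assoc, ← integral_const_mul]
  refine setIntegral_congr_fun measurableSet_Ioi fun t ht => ?_
  have h : (ζ : ℂ × ℂ).2.im = ‖(ζ : ℂ × ℂ).1‖ ^ γ := ζ.2
  have h2 : (ζ : ℂ × ℂ).2 = (ζ : ℂ × ℂ).2.re + (‖(ζ : ℂ × ℂ).1‖ ^ γ : ℝ) * Complex.I := by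
    rw [← h, Complex.re_add_im]
  have hne : ((‖(ζ : ℂ × ℂ).1‖ : ℝ) : ℂ) ≠ 0 := by exact_mod_cast hζ.ne'
  have h3 : conj (coeff γ (lift ε ζ) k t) = (2 * Real.pi : ℂ)⁻¹ * gain γ k * profileConst γ k 1
      * (t ^ profileExp γ k : ℝ) * (ζ : ℂ × ℂ).1 ^ k
      * (Complex.exp (t * (ζ : ℂ × ℂ).2.re * Complex.I) * Complex.exp (-(|ε| * t : ℝ))
        * Complex.exp (-(t * 1 * ‖(ζ : ℂ × ℂ).1‖ ^ γ : ℝ))) := by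
    rw [coeff, ← Complex.exp_add, ← Complex.exp_add]
    simp only [map_mul, map_inv₀, map_ofNat, Complex.conj_ofReal, map_pow, Complex.conj_conj,
      ← Complex.exp_conj, map_neg, Complex.conj_I, lift]
    congr 2
    rw [abs_of_pos hε]
    push_cast
    linear_combination (t * (‖(ζ : ℂ × ℂ).1‖ ^ γ : ℝ) + t * ε) * Complex.I_sq + Complex.I * t * h2
  rw [RCLike.inner_apply, h3, profileMul, profile, Real.rpow_natCast, div_pow]
  push_cast
  field_simp

/-- The diagonal operator with entries `gain γ k • T`. -/
def gainDiag (hγ : 1 < γ) (T : HalfL2 →L[ℂ] HalfL2) (hT : ‖T‖ ≤ 1) : Spectral →L[ℂ] Spectral :=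
  diag (fun k => (gain γ k : ℂ) • T) (gain γ 0) (gain_pos hγ 0).le fun k => by
    rw [norm_smul, Complex.norm_real, Real.norm_of_nonneg (gain_pos hγ k).le]
    exact (mul_le_of_le_one_right (gain_pos hγ k).le hT).trans (gain_le hγ k)

theorem gainDiag_apply (hγ : 1 < γ) (T : HalfL2 →L[ℂ] HalfL2) (hT : ‖T‖ ≤ 1) (g : Spectral)
    (k : ℕ) : gainDiag hγ T hT g k = (gain γ k : ℂ) • T (g k) := rfl

/-- The Leray transform of `M_γ` on `L²(M_γ, σ)`. -/
def leray (hγ : 1 < γ) : Lp ℂ 2 (sigma γ) →L[ℂ] Lp ℂ 2 (sigma γ) :=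
  outSynthesis hγ ∘L gainDiag hγ (.id ℂ HalfL2) ContinuousLinearMap.norm_id_le ∘L analysis hγ

/-- The operator `f ↦ (ζ ↦ Lf(ζ₁, ζ₂ + i|ε|))` on `L²(M_γ, σ)`. -/
def lerayDamped (hγ : 1 < γ) (ε : ℝ) : Lp ℂ 2 (sigma γ) →L[ℂ] Lp ℂ 2 (sigma γ) :=
  outSynthesis hγ ∘L gainDiag hγ (damp ε) (norm_damp_le ε) ∘L analysis hγ

theorem leray_apply (hγ : 1 < γ) (f : Lp ℂ 2 (sigma γ)) :
    leray hγ f = outSynthesis hγ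
      (gainDiag hγ (.id ℂ HalfL2) ContinuousLinearMap.norm_id_le (analysis hγ f)) := by
  rw [leray, ContinuousLinearMap.comp_apply, ContinuousLinearMap.comp_apply]

theorem lerayDamped_apply (hγ : 1 < γ) (ε : ℝ) (f : Lp ℂ 2 (sigma γ)) :
    lerayDamped hγ ε f
      = outSynthesis hγ (gainDiag hγ (damp ε) (norm_damp_le ε) (analysis hγ f)) := by
  rw [lerayDamped, ContinuousLinearMap.comp_apply, ContinuousLinearMap.comp_apply]

theorem hasSum_leray (hγ : 1 < γ) (f : Lp ℂ 2 (sigma γ)) :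
    HasSum (fun k => outWave hγ k ((gain γ k : ℂ) • analysis hγ f k)) (leray hγ f) := by
  have h := hasSum_outSynthesis hγ
    (gainDiag hγ (.id ℂ HalfL2) ContinuousLinearMap.norm_id_le (analysis hγ f))
  simp only [gainDiag_apply, ContinuousLinearMap.id_apply] at h
  rwa [leray_apply]

theorem hasSum_lerayDamped (hγ : 1 < γ) (ε : ℝ) (f : Lp ℂ 2 (sigma γ)) :
    HasSum (fun k => outWave hγ k ((gain γ k : ℂ) • damp ε (analysis hγ f k)))
      (lerayDamped hγ ε f) := by
  have h := hasSum_outSynthesis hγ (gainDiag hγ (damp ε) (norm_damp_le ε) (analysis hγ f))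
  simp only [gainDiag_apply] at h
  rwa [lerayDamped_apply]

/-- One series converges to the left side in `L²` and to the right side pointwise. -/
theorem transform_lift_ae (hγ : 1 < γ) {ε : ℝ} (hε : 0 < ε) (f : Lp ℂ 2 (sigma γ)) :
    lerayDamped hγ ε f =ᵐ[sigma γ] fun ζ : M γ => transform γ f (lift ε ζ) := by
  refine ae_eq_of_hasSum (hasSum_lerayDamped hγ ε f)
    (f := fun k ζ => gain γ k * wave k (profileMul γ k 1 (damp ε (analysis hγ f k))) ζ)
    (fun k => ?_) ?_
  · rw [map_smul]
    filter_upwards [Lp.coeFn_smul (gain γ k : ℂ) (outWave hγ k (damp ε (analysis hγ f k))),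
      coeFn_waveLp (m := k) (b := 1) (zero_lt_one.trans hγ) k.cast_nonneg one_pos k
        (damp ε (analysis hγ f k))] with ζ h1 h2
    rw [h1, Pi.smul_apply, smul_eq_mul, outWave, h2]
  · filter_upwards [ae_fst_ne_zero (zero_lt_one.trans hγ)] with ζ hζ
    simp only [← integral_inner_coeff_lift hε hζ]
    exact hasSum_transform hγ (lift_mem_Omega hε ζ) f

theorem tendsto_lerayDamped (hγ : 1 < γ) (f : Lp ℂ 2 (sigma γ)) :
    Tendsto (fun ε => lerayDamped hγ ε f) (𝓝[>] 0) (𝓝 (leray hγ f)) := by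
  refine ((outSynthesis hγ).continuous.tendsto _).comp (tendsto_of_tendsto_entries (C := gain γ 0)
    (analysis hγ f) (fun ε => gainDiag hγ (damp ε) (norm_damp_le ε) (analysis hγ f))
    (fun ε k => ?_) (gainDiag hγ (.id ℂ HalfL2) ContinuousLinearMap.norm_id_le (analysis hγ f))
    fun k => ?_)
  · rw [gainDiag_apply, norm_smul, Complex.norm_real, Real.norm_of_nonneg (gain_pos hγ k).le]
    refine mul_le_mul (gain_le hγ k) ?_ (norm_nonneg _) (gain_pos hγ 0).le
    exact ((damp ε).le_opNorm _).trans (mul_le_of_le_one_left (norm_nonneg _) (norm_damp_le ε))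
  · simp only [gainDiag_apply, ContinuousLinearMap.id_apply]
    exact (tendsto_damp _).const_smul _

theorem isTransform_leray (hγ : 1 < γ) (f : Lp ℂ 2 (sigma γ)) : IsTransform γ f (leray hγ f) := by
  refine ⟨fun z hz => integrableOn_integrand hγ (integrable_mul_density hγ hz f), fun ε hε => ?_, ?_⟩
  · exact (memLp_congr_ae (transform_lift_ae hγ hε f)).1 (Lp.memLp _)
  · refine ((Lp.tendsto_Lp_iff_tendsto_eLpNorm' _ _).1 (tendsto_lerayDamped hγ f)).congr' ?_
    filter_upwards [self_mem_nhdsWithin] with ε hε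
    refine eLpNorm_congr_ae ?_
    filter_upwards [transform_lift_ae hγ hε f] with ζ hζ
    rw [Pi.sub_apply, hζ]

theorem leray_comp_leray (hγ : 1 < γ) : leray hγ ∘L leray hγ = leray hγ := by
  ext1 f
  rw [ContinuousLinearMap.comp_apply]
  refine (hasSum_leray hγ (leray hγ f)).unique ?_
  convert hasSum_leray hγ f using 4 with k
  rw [leray_apply, analysis_outSynthesis, gainDiag_apply, ContinuousLinearMap.id_apply, smul_smul,
    inv_mul_cancel₀ (by exact_mod_cast (gain_pos hγ k).ne'), one_smul]

theorem norm_leray_le (hγ : 1 < γ) : ‖leray hγ‖ ≤ gain γ 0 := by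
  refine ContinuousLinearMap.opNorm_le_bound _ (gain_pos hγ 0).le fun f => ?_
  rw [leray_apply, norm_outSynthesis]
  refine (ContinuousLinearMap.le_opNorm _ _).trans ?_
  refine mul_le_mul (norm_diag_le _ _ _ _) ?_ (norm_nonneg _) (gain_pos hγ 0).le
  exact ((analysis hγ).le_opNorm f).trans
    (mul_le_of_le_one_left (norm_nonneg _) (norm_analysis_le hγ))

theorem analysis_inWave (hγ : 1 < γ) (k l : ℕ) (φ : HalfL2) :
    analysis hγ (inWave hγ k φ) l = if l = k then φ else 0 := by
  rw [analysis_apply]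
  refine ext_inner_left ℂ fun ψ => ?_
  rw [ContinuousLinearMap.adjoint_inner_right]
  split_ifs with h
  · rw [h]
    exact (inWave hγ k).inner_map_map ψ φ
  · rw [inner_zero_right]
    exact orthogonalFamily_inWave hγ h ψ φ

theorem norm_leray_inWave_zero (hγ : 1 < γ) (φ : HalfL2) :
    ‖leray hγ (inWave hγ 0 φ)‖ = gain γ 0 * ‖inWave hγ 0 φ‖ := by
  have h := hasSum_leray hγ (inWave hγ 0 φ)
  simp only [analysis_inWave] at h
  rw [h.unique (hasSum_single 0 fun l hl => by rw [if_neg hl, smul_zero, map_zero]), if_pos rfl,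
    LinearIsometry.norm_map, LinearIsometry.norm_map, norm_smul, Complex.norm_real,
    Real.norm_of_nonneg (gain_pos hγ 0).le]

/-- The indicators of the intervals `(n, n+1]` are orthonormal. -/
theorem not_finiteDimensional_halfL2 : ¬ FiniteDimensional ℂ HalfL2 := by
  intro hfin
  let s : ℕ → Set ℝ := fun n => Ioc (n : ℝ) (n + 1)
  have hs : ∀ n, MeasurableSet (s n) := fun n => measurableSet_Ioc
  have hμ : ∀ n, halfLine (s n) = 1 := fun n => by
    rw [Measure.restrict_apply (hs n), inter_eq_left.2 fun x hx =>
      mem_Ioi.2 ((Nat.cast_nonneg n).trans_lt hx.1), Real.volume_Ioc]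
    simp
  have hfin' : ∀ n, halfLine (s n) ≠ ⊤ := fun n => by simp [hμ n]
  have hdisj : ∀ m n, m ≠ n → s m ∩ s n = ∅ := fun m n hmn => by
    refine eq_empty_of_forall_notMem fun x hx => ?_
    have h1 : (m : ℝ) < n + 1 := hx.1.1.trans_le hx.2.2
    have h2 : (n : ℝ) < m + 1 := hx.2.1.trans_le hx.1.2
    norm_cast at h1 h2
    omega
  let e : ℕ → HalfL2 := fun n => indicatorConstLp 2 (hs n) (hfin' n) 1
  have hinner : ∀ m n, inner ℂ (e m) (e n) = if m = n then 1 else 0 := fun m n => by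
    rw [L2.inner_indicatorConstLp_one_indicatorConstLp_one (hs m) (hs n) (hfin' m) (hfin' n)]
    split_ifs with h
    · rw [h, inter_self, measureReal_def, hμ]; simp
    · rw [hdisj m n h]; simp
  have he : Orthonormal ℂ e := orthonormal_iff_ite.2 hinner
  exact Set.infinite_univ (α := ℕ) (Set.finite_univ_iff.2 (he.linearIndependent.finite))

end Operator

end Leray

end

/-! ### Norm, extremal subspace and essential norm. -/

theorem theorem1p1 (γ : ℝ) (hγ : 1 < γ) :
    ∃ L : Lp ℂ 2 (Leray.sigma γ) →L[ℂ] Lp ℂ 2 (Leray.sigma γ),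
      (∀ f : Lp ℂ 2 (Leray.sigma γ), Leray.IsTransform γ f (L f)) ∧
      L ∘L L = L ∧
      ‖L‖ = γ / (2 * √(γ - 1)) ∧
      (∃ V : Submodule ℂ (Lp ℂ 2 (Leray.sigma γ)), ¬ FiniteDimensional ℂ V ∧
        ∀ f ∈ V, ‖L f‖ = γ / (2 * √(γ - 1)) * ‖f‖) ∧
      Leray.essentialNorm L = γ / (2 * √(γ - 1)) := by
  have hc := Leray.gain_zero hγ
  have hinf : ¬ FiniteDimensional ℂ (LinearMap.range (Leray.inWave hγ 0).toLinearMap) := fun h =>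
    Leray.not_finiteDimensional_halfL2 <| by
      exact Module.Finite.of_injective (Leray.inWave hγ 0).toLinearMap.rangeRestrict
        fun x y hxy => (Leray.inWave hγ 0).injective (congrArg Subtype.val hxy)
  have hV : ∀ f ∈ LinearMap.range (Leray.inWave hγ 0).toLinearMap,
      ‖Leray.leray hγ f‖ = γ / (2 * √(γ - 1)) * ‖f‖ := by
    rintro _ ⟨φ, rfl⟩
    rw [← hc]
    exact Leray.norm_leray_inWave_zero hγ φ
  have hnorm : ‖Leray.leray hγ‖ = γ / (2 * √(γ - 1)) := by
    refine le_antisymm (hc ▸ Leray.norm_leray_le hγ) ?_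
    -- Any nonzero vector of the extremal subspace gives the lower bound for the norm.
    have hnt : Nontrivial (LinearMap.range (Leray.inWave hγ 0).toLinearMap) := by
      by_contra h
      rw [not_nontrivial_iff_subsingleton] at h
      exact hinf inferInstance
    obtain ⟨⟨f, hf⟩, hne⟩ := exists_ne (0 : LinearMap.range (Leray.inWave hγ 0).toLinearMap)
    have hpos : 0 < ‖f‖ := norm_pos_iff.2 fun h => hne (Subtype.ext h)
    have h := (Leray.leray hγ).le_opNorm f
    rw [hV f hf] at h
    exact le_of_mul_le_mul_right h hpos
  exact ⟨Leray.leray hγ, Leray.isTransform_leray hγ, Leray.leray_comp_leray hγ, hnorm,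
    ⟨_, hinf, hV⟩, Leray.essentialNorm_eq_of_forall_mem _ hinf hV hnorm⟩
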